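/- Let $X$ be a smooth finite-dimensional manifold without boundary (neither compactness nor connectedness is needed) with a smooth involution $\tau:X\to X$, $\tau^2=\mathrm{Id}$. Let $\pi:P\to X$ be a smooth principal $U(m)$-bundle, with right action $(p,u)\mapsto pu$, endowed with a "Real" structure, i.e. a smooth map $\hat\Theta:P\to P$ with $\pi\circ\hat\Theta=\tau\circ\pi$, $\hat\Theta^2=\mathrm{Id}$ and $\hat\Theta(pu)=\hat\Theta(p)\,\overline{u}$ for all $p\in P$, $u\in U(m)$. Let $\omega\in\Omega^1(P,\mathfrak u(m))$ be a connection 1-form on $P$ which is "Real", i.e. $\hat\Theta^*\overline{\omega}=\omega$, and let $F_\omega=d\omega+\tfrac12[\omega\wedge\omega]$ be its curvature. For $k\ge 0$ let $C_k$ be the symmetric $k$-linear form on $\mathfrak u(m)$ determined by $$\det\Big(t\mathbf 1-\frac{1}{2\pi i}\xi\Big)=\sum_{k=0}^m C_k(\xi,\dots,\xi)\,t^{m-k},\qquad \xi\in\mathfrak u(m),$$ with $C_k=0$ for $k>m$. For $\varepsilon=\pm1$ let $\Omega^\bullet_{\pm}(X)=\{\alpha\in\Omega^\bullet(X)\mid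 \tau^*\alpha=\pm\alpha\}$, a subcomplex of the complex $\Omega^\bullet(X)$ of smooth real forms on $X$, and let $H^\bullet_{\mathrm{dR},\pm}(X)$ be its cohomology. Then for every $k\ge0$ there is a unique smooth real form $\hat C_k\in\Omega^{2k}(X)$ (the $k$-th Chern form of $\omega$) such that $\pi^*\hat C_k=C_k(F_\omega\wedge\dots\wedge F_\omega)$. It is closed, it satisfies $$\tau^*\hat C_k=(-1)^k\,\hat C_k,$$ and the $k$-th differential Chern class $c_k=[\hat C_k]\in H^{2k}_{\mathrm{dR}}(X)$ lies in $H^{2k}_{\mathrm{dR},+}(X)$ if $k$ is even and in $H^{2k}_{\mathrm{dR},-}(X)$ if $k$ is odd: it is the image of exactly one class under the map $H^{2k}_{\mathrm{dR},\pm}(X)\to H^{2k}_{\mathrm{dR}}(X)$ induced by the inclusion $\Omega^\bullet_\pm(X)\subset\Omega^\bullet(X)$. -/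

import Mathlib

open scoped Manifold ContDiff Matrix.Norms.L2Operator

namespace RealChernWeil

noncomputable section

/-- Complex `m × m` matrices. -/
abbrev Mat (m : ℕ) : Type := Matrix (Fin m) (Fin m) ℂ

/-- The unitary group `U(m)`. -/
abbrev U (m : ℕ) : Type := Matrix.unitaryGroup (Fin m) ℂ

/-- The Lie algebra `𝔲(m)` of anti-Hermitian matrices, a real vector space. -/
abbrev uLie (m : ℕ) : Submodule ℝ (Mat m) := skewAdjoint.submodule ℝ (Mat m)

theorem mem_uLie {m : ℕ} {A : Mat m} : A ∈ uLie m ↔ star A = -A := Iff.rfl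

/-- The Cayley transform `A ↦ (1 - A)(1 + A)⁻¹`. -/
def cayley {m : ℕ} (A : Mat m) : Mat m := (1 - A) * (1 + A)⁻¹

theorem one_add_cayley {m : ℕ} {A : Mat m} (h : IsUnit (1 + A)) :
    1 + cayley A = (2 : ℂ) • (1 + A)⁻¹ := by
  have h' : IsUnit (1 + A).det := (Matrix.isUnit_iff_isUnit_det _).1 h
  have e : (1 : Mat m) = (1 + A) * (1 + A)⁻¹ := (Matrix.mul_nonsing_inv _ h').symm
  unfold cayley
  nth_rewrite 1 [e]
  rw [← add_mul, show (1 + A) + (1 - A) = (2 : ℂ) • (1 : Mat m) by rw [two_smul]; abel,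
    Matrix.smul_mul, one_mul]

theorem one_sub_cayley {m : ℕ} {A : Mat m} (h : IsUnit (1 + A)) :
    1 - cayley A = (2 : ℂ) • (A * (1 + A)⁻¹) := by
  have h' : IsUnit (1 + A).det := (Matrix.isUnit_iff_isUnit_det _).1 h
  have e : (1 : Mat m) = (1 + A) * (1 + A)⁻¹ := (Matrix.mul_nonsing_inv _ h').symm
  unfold cayley
  nth_rewrite 1 [e]
  rw [← sub_mul, show (1 + A) - (1 - A) = (2 : ℂ) • A by rw [two_smul]; abel,
    Matrix.smul_mul]

theorem isUnit_one_add_cayley {m : ℕ} {A : Mat m} (h : IsUnit (1 + A)) :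
    IsUnit (1 + cayley A) := by
  have h' : IsUnit (1 + A).det := (Matrix.isUnit_iff_isUnit_det _).1 h
  rw [one_add_cayley h]
  refine IsUnit.of_mul_eq_one ((2 : ℂ)⁻¹ • (1 + A)) ?_
  rw [Matrix.smul_mul, Matrix.mul_smul, smul_smul, Matrix.nonsing_inv_mul _ h']
  norm_num

theorem cayley_cayley {m : ℕ} {A : Mat m} (h : IsUnit (1 + A)) : cayley (cayley A) = A := by
  have h' : IsUnit (1 + A).det := (Matrix.isUnit_iff_isUnit_det _).1 h
  have e : (1 + cayley A)⁻¹ = (2 : ℂ)⁻¹ • (1 + A) := by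
    rw [one_add_cayley h]
    refine Matrix.inv_eq_right_inv ?_
    rw [Matrix.smul_mul, Matrix.mul_smul, smul_smul, Matrix.nonsing_inv_mul _ h']
    norm_num
  rw [cayley, e, one_sub_cayley h, Matrix.smul_mul, Matrix.mul_smul, smul_smul, mul_assoc,
    Matrix.nonsing_inv_mul _ h', mul_one]
  norm_num

open scoped ComplexOrder in
theorem isUnit_one_add_of_mem {m : ℕ} {A : Mat m} (hA : A ∈ uLie m) : IsUnit (1 + A) := by
  have hA' : A.conjTranspose = -A := hA
  have h1 : (1 + A).conjTranspose * (1 + A) = 1 + A.conjTranspose * A := by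
    rw [Matrix.conjTranspose_add, Matrix.conjTranspose_one, hA']
    noncomm_ring
  have h2 : ((1 + A).conjTranspose * (1 + A)).PosDef := by
    rw [h1]
    exact Matrix.PosDef.one.add_posSemidef (Matrix.posSemidef_conjTranspose_mul_self A)
  have h3 := (Matrix.isUnit_iff_isUnit_det _).1 h2.isUnit
  rw [Matrix.det_mul] at h3
  exact (Matrix.isUnit_iff_isUnit_det _).2 (isUnit_of_mul_isUnit_right h3)

theorem cayley_mem_unitary {m : ℕ} {A : Mat m} (hA : A ∈ uLie m) :
    cayley A ∈ Matrix.unitaryGroup (Fin m) ℂ := by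
  have hA' : A.conjTranspose = -A := hA
  have h1 : IsUnit (1 + A).det := (Matrix.isUnit_iff_isUnit_det _).1 (isUnit_one_add_of_mem hA)
  have h2 : IsUnit (1 - A).det := by
    have := (Matrix.isUnit_iff_isUnit_det _).1 (isUnit_one_add_of_mem ((uLie m).neg_mem hA))
    rwa [← sub_eq_add_neg] at this
  rw [Matrix.mem_unitaryGroup_iff']
  have h3 : star (cayley A) = (1 - A)⁻¹ * (1 + A) := by
    rw [cayley, Matrix.star_eq_conjTranspose, Matrix.conjTranspose_mul,
      Matrix.conjTranspose_nonsing_inv, Matrix.conjTranspose_add, Matrix.conjTranspose_sub,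
      Matrix.conjTranspose_one, hA', sub_neg_eq_add, ← sub_eq_add_neg]
  have h4 : (1 + A) * (1 - A) = (1 - A) * (1 + A) := by noncomm_ring
  rw [h3, cayley, mul_assoc, ← mul_assoc (1 + A), h4, mul_assoc (1 - A),
    Matrix.mul_nonsing_inv _ h1, mul_one, Matrix.nonsing_inv_mul _ h2]

theorem cayley_mem_uLie {m : ℕ} {w : Mat m} (hw : w ∈ Matrix.unitaryGroup (Fin m) ℂ)
    (h : IsUnit (1 + w)) : cayley w ∈ uLie m := by
  have h1 : IsUnit (1 + w).det := (Matrix.isUnit_iff_isUnit_det _).1 h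
  have h2 : IsUnit (1 + star w).det := by
    have := h.star
    rw [star_add, star_one] at this
    exact (Matrix.isUnit_iff_isUnit_det _).1 this
  have hu : star w * w = 1 := (Matrix.mem_unitaryGroup_iff').1 hw
  rw [mem_uLie]
  have h3 : star (cayley w) = (1 + star w)⁻¹ * (1 - star w) := by
    rw [cayley, star_mul, Matrix.star_eq_conjTranspose, Matrix.star_eq_conjTranspose,
      Matrix.conjTranspose_nonsing_inv, Matrix.conjTranspose_add, Matrix.conjTranspose_sub,
      Matrix.conjTranspose_one, Matrix.star_eq_conjTranspose]
  have h4 : (1 - star w) * (1 + w) = (1 + star w) * -(1 - w) := by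
    have e1 : (1 - star w) * (1 + w) = 1 + w - star w - star w * w := by noncomm_ring
    have e2 : (1 + star w) * -(1 - w) = -1 + w - star w + star w * w := by noncomm_ring
    rw [e1, e2, hu]; abel
  have h5 : (1 - star w) = (1 + star w) * -(1 - w) * (1 + w)⁻¹ := by
    rw [← h4, mul_assoc, Matrix.mul_nonsing_inv _ h1, mul_one]
  rw [h3, h5, ← mul_assoc, ← mul_assoc, Matrix.nonsing_inv_mul _ h2, one_mul, cayley, neg_mul]

theorem contDiffAt_cayley {m : ℕ} {A : Mat m} (h : IsUnit (1 + A)) :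
    ContDiffAt ℝ ∞ (cayley (m := m)) A := by
  have h0 : cayley (m := m) = fun A => (1 - A) * Ring.inverse (1 + A) := by
    funext A; rw [cayley, Matrix.nonsing_inv_eq_ringInverse]
  rw [h0]
  obtain ⟨u, hu⟩ := h
  have h1 : ContDiffAt ℝ ∞ Ring.inverse (1 + A) := hu ▸ contDiffAt_ringInverse ℝ u
  have h2 : ContDiffAt ℝ ∞ (fun A : Mat m => 1 + A) A := contDiffAt_const.add contDiffAt_id
  have h3 : ContDiffAt ℝ ∞ (fun A : Mat m => 1 - A) A := contDiffAt_const.sub contDiffAt_id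
  exact h3.mul (h1.comp A h2)

/-- The real-linear projection `A ↦ (A - A*) / 2` of the matrices onto `𝔲(m)`. -/
def skewPart (m : ℕ) : Mat m →L[ℝ] uLie m :=
  LinearMap.toContinuousLinearMap (skewAdjointPart ℝ : Mat m →ₗ[ℝ] skewAdjoint (Mat m))

theorem skewPart_coe {m : ℕ} {A : Mat m} (hA : A ∈ uLie m) : (skewPart m A : Mat m) = A := by
  have : star A = -A := hA
  change (⅟2 : ℝ) • (A - star A) = A
  rw [this, sub_neg_eq_add, ← two_smul ℝ, smul_smul, invOf_mul_self, one_smul]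

/-- The Cayley chart of `U(m)` centred at `u`: it maps `v` to the Cayley transform of `u⁻¹ v`, is
defined where `1 + u⁻¹ v` is invertible, and takes all values in `𝔲(m)`. -/
def cayleyChart {m : ℕ} (u : U m) : OpenPartialHomeomorph (U m) (uLie m) where
  toFun v := skewPart m (cayley ((u⁻¹ * v : U m) : Mat m))
  invFun A := u * ⟨cayley (A : Mat m), cayley_mem_unitary A.2⟩
  source := {v | IsUnit (1 + ((u⁻¹ * v : U m) : Mat m))}
  target := Set.univ
  map_source' _ _ := Set.mem_univ _
  map_target' A _ := by
    change IsUnit (1 + ((u⁻¹ * (u * ⟨cayley (A : Mat m), cayley_mem_unitary A.2⟩) : U m) : Mat m))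
    rw [inv_mul_cancel_left]
    exact isUnit_one_add_cayley (isUnit_one_add_of_mem A.2)
  left_inv' v hv := by
    have h1 := skewPart_coe (cayley_mem_uLie (u⁻¹ * v).2 hv)
    have h2 : (⟨cayley (skewPart m (cayley ((u⁻¹ * v : U m) : Mat m)) : Mat m),
        cayley_mem_unitary (skewPart m _).2⟩ : U m) = u⁻¹ * v := by
      apply Subtype.ext
      change cayley _ = _
      rw [h1, cayley_cayley hv]
    rw [h2, mul_inv_cancel_left]
  right_inv' A _ := by
    apply Subtype.ext
    rw [inv_mul_cancel_left]
    rw [cayley_cayley (isUnit_one_add_of_mem A.2), skewPart_coe A.2]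
  open_source := by
    refine Units.isOpen.preimage (f := fun v : U m => 1 + ((u⁻¹ * v : U m) : Mat m)) ?_
    fun_prop
  open_target := isOpen_univ
  continuousOn_toFun := by
    intro v hv
    have h1 : ContinuousAt (cayley (m := m)) ((u⁻¹ * v : U m) : Mat m) :=
      (contDiffAt_cayley hv).continuousAt
    have h2 : ContinuousAt (fun v : U m => ((u⁻¹ * v : U m) : Mat m)) v := by fun_prop
    exact ((skewPart m).continuous.continuousAt.comp
      (ContinuousAt.comp (f := fun v : U m => ((u⁻¹ * v : U m) : Mat m)) h1 h2)).continuousWithinAt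
  continuousOn_invFun := by
    refine Continuous.continuousOn ?_
    refine continuous_const.mul (Continuous.subtype_mk ?_ _)
    refine continuous_iff_continuousAt.2 fun A => ?_
    exact ContinuousAt.comp (f := fun A : uLie m => (A : Mat m))
      (contDiffAt_cayley (isUnit_one_add_of_mem A.2)).continuousAt
      continuous_subtype_val.continuousAt

/-- `U(m)` as a manifold modelled on `𝔲(m)`, through the Cayley charts. -/
instance instChartedSpaceU (m : ℕ) : ChartedSpace (uLie m) (U m) where
  atlas := Set.range cayleyChart
  chartAt := cayleyChart
  mem_chart_source u := by
    change IsUnit (1 + ((u⁻¹ * u : U m) : Mat m))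
    rw [inv_mul_cancel]
    refine IsUnit.of_mul_eq_one ((2 : ℂ)⁻¹ • (1 : Mat m)) ?_
    change (1 + 1 : Mat m) * _ = 1
    rw [← two_smul ℂ, Matrix.smul_mul, Matrix.mul_smul, smul_smul, one_mul]
    norm_num
  chart_mem_atlas u := Set.mem_range_self u

/-- `U(m)` is a smooth manifold. -/
instance instIsManifoldU (m : ℕ) : IsManifold 𝓘(ℝ, uLie m) ∞ (U m) := by
  refine isManifold_of_contDiffOn _ _ _ ?_
  rintro _ _ ⟨u, rfl⟩ ⟨v, rfl⟩ A hA
  refine ContDiffAt.contDiffWithinAt ?_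
  have hA' : IsUnit (1 + ((v⁻¹ : U m) : Mat m) * ((u : Mat m) * cayley (A : Mat m))) := by
    have := hA.1.2
    exact this
  have h1 : ContDiffAt ℝ ∞ (fun A : uLie m => cayley (A : Mat m)) A :=
    ContDiffAt.comp A (contDiffAt_cayley (isUnit_one_add_of_mem A.2))
      (uLie m).subtypeL.contDiff.contDiffAt
  have h2 : ContDiffAt ℝ ∞
      (fun A : uLie m => ((v⁻¹ : U m) : Mat m) * ((u : Mat m) * cayley (A : Mat m))) A :=
    contDiffAt_const.mul (contDiffAt_const.mul h1)
  have h3 : ContDiffAt ℝ ∞ (fun A : uLie m =>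
      cayley (((v⁻¹ : U m) : Mat m) * ((u : Mat m) * cayley (A : Mat m)))) A :=
    ContDiffAt.comp A (contDiffAt_cayley hA') h2
  have h4 : ContDiffAt ℝ ∞ (fun A : uLie m => skewPart m
      (cayley (((v⁻¹ : U m) : Mat m) * ((u : Mat m) * cayley (A : Mat m))))) A :=
    (skewPart m).contDiff.contDiffAt.comp A h3
  exact h4


/-! ### The polynomials `C_k` -/

/-- The entry `A ↦ A a b` as a continuous real-linear map. -/
def entryCLM (m : ℕ) (a b : Fin m) : Mat m →L[ℝ] ℂ :=
  LinearMap.toContinuousLinearMap (Matrix.entryLinearMap ℝ ℂ a b)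

/-- The polarized Chern polynomial `C_k`, a symmetric `k`-linear map on matrices:
`C_k(A₁, …, A_k) = (-1 / (2πi))^k (1 / k!) ∑_f ∑_σ sgn σ ∏ᵢ (Aᵢ)_{f (σ i), f i}`, with `f` running
over all maps `{1, …, k} → {1, …, m}` and `σ` over the permutations of `{1, …, k}`. It is the
symmetric multilinear map with
`det (t - ξ / (2πi)) = ∑_k C_k(ξ, …, ξ) t^(m - k)`, see `chernPoly_symm` and `det_eq_chernPoly`. -/
def chernPoly (m k : ℕ) : ContinuousMultilinearMap ℝ (fun _ : Fin k => Mat m) ℂ :=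
  ((-(1 / (2 * Real.pi * Complex.I))) ^ k * ((k.factorial : ℂ))⁻¹) •
    ∑ f : Fin k → Fin m, ∑ σ : Equiv.Perm (Fin k), ((Equiv.Perm.sign σ : ℤ) : ℂ) •
      (ContinuousMultilinearMap.mkPiAlgebra ℝ (Fin k) ℂ).compContinuousLinearMap
        (fun i => entryCLM m (f (σ i)) (f i))

theorem chernPoly_apply (m k : ℕ) (A : Fin k → Mat m) :
    chernPoly m k A = ((-(1 / (2 * Real.pi * Complex.I))) ^ k * ((k.factorial : ℂ))⁻¹) *
      ∑ f : Fin k → Fin m, ∑ σ : Equiv.Perm (Fin k), ((Equiv.Perm.sign σ : ℤ) : ℂ) *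
        ∏ i, A i (f (σ i)) (f i) := by
  simp [chernPoly, entryCLM]

theorem chernPoly_symm (m k : ℕ) (A : Fin k → Mat m) (ρ : Equiv.Perm (Fin k)) :
    chernPoly m k (fun i => A (ρ i)) = chernPoly m k A := by
  rw [chernPoly_apply, chernPoly_apply]
  congr 1
  refine Fintype.sum_equiv (Equiv.arrowCongr ρ (Equiv.refl _)) _ _ fun f => ?_
  refine Fintype.sum_equiv (MulAut.conj ρ).toEquiv _ _ fun σ => ?_
  congr 1
  · simp [mul_right_comm]
  · refine Fintype.prod_equiv ρ _ _ fun i => ?_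
    simp

theorem sum_minors_eq (m k : ℕ) (A : Mat m) :
    (k.factorial : ℂ) * ∑ s ∈ (Finset.univ : Finset (Fin m)).powersetCard k,
      (A.submatrix (Subtype.val : s → Fin m) (Subtype.val : s → Fin m)).det =
    ∑ f : Fin k → Fin m, (A.submatrix f f).det := by
  classical
  have h1 : ∑ f : Fin k → Fin m, (A.submatrix f f).det =
      ∑ f : Fin k → Fin m with Function.Injective f, (A.submatrix f f).det := by
    refine (Finset.sum_filter_of_ne fun f _ hf => ?_).symm
    by_contra hinj
    simp only [Function.Injective, not_forall] at hinj
    obtain ⟨i, j, hij, hne⟩ := hinj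
    refine hf (Matrix.det_zero_of_row_eq hne ?_)
    funext l
    simp [hij]
  have h2 : ∀ f ∈ ({f : Fin k → Fin m | Function.Injective f} : Finset _),
      Finset.univ.image f ∈ (Finset.univ : Finset (Fin m)).powersetCard k := by
    intro f hf
    simp only [Finset.mem_filter, Finset.mem_univ, true_and] at hf
    simp [Finset.mem_powersetCard, Finset.card_image_of_injective _ hf]
  rw [h1, ← Finset.sum_fiberwise_of_maps_to h2, Finset.mul_sum]
  refine Finset.sum_congr rfl fun s hs => ?_
  have hsc : s.card = k := (Finset.mem_powersetCard.1 hs).2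
  have h3 : ∀ f ∈ ({f ∈ ({f : Fin k → Fin m | Function.Injective f} : Finset _) |
      Finset.univ.image f = s} : Finset _), (A.submatrix f f).det =
      (A.submatrix (Subtype.val : s → Fin m) (Subtype.val : s → Fin m)).det := by
    intro f hf
    simp only [Finset.mem_filter, Finset.mem_univ, true_and] at hf
    obtain ⟨hinj, him⟩ := hf
    have hmem : ∀ i, f i ∈ s := fun i => him ▸ Finset.mem_image_of_mem f (Finset.mem_univ i)
    have hbij : Function.Bijective (fun i => (⟨f i, hmem i⟩ : s)) := by
      rw [Fintype.bijective_iff_injective_and_card]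
      exact ⟨fun i j h => hinj (congrArg Subtype.val h), by simp [hsc]⟩
    have := Matrix.det_submatrix_equiv_self (Equiv.ofBijective _ hbij)
      (A.submatrix (Subtype.val : s → Fin m) (Subtype.val : s → Fin m))
    rw [← this]
    rfl
  rw [Finset.sum_congr rfl h3, Finset.sum_const, nsmul_eq_mul]
  congr 2
  have e0 : Fin k ≃ s := Fintype.equivOfCardEq (by simp [hsc])
  have h4 : k.factorial = Fintype.card (Fin k ≃ s) := by
    rw [Fintype.card_equiv e0, Fintype.card_fin]
  rw [h4, ← Finset.card_univ]
  refine Finset.card_bij (fun e _ i => (e i : Fin m)) ?_ ?_ ?_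
  · intro e _
    simp only [Finset.mem_filter, Finset.mem_univ, true_and]
    refine ⟨fun i j h => e.injective (Subtype.ext h), ?_⟩
    ext x
    simp only [Finset.mem_image, Finset.mem_univ, true_and]
    exact ⟨fun ⟨i, hi⟩ => hi ▸ (e i).2, fun hx => ⟨e.symm ⟨x, hx⟩, by simp⟩⟩
  · intro e _ e' _ h
    ext i
    exact congrArg Fin.val (congrFun h i)
  · intro f hf
    simp only [Finset.mem_filter, Finset.mem_univ, true_and] at hf
    obtain ⟨hinj, him⟩ := hf
    have hmem : ∀ i, f i ∈ s := fun i => him ▸ Finset.mem_image_of_mem f (Finset.mem_univ i)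
    have hbij : Function.Bijective (fun i => (⟨f i, hmem i⟩ : s)) := by
      rw [Fintype.bijective_iff_injective_and_card]
      exact ⟨fun i j h => hinj (congrArg Subtype.val h), by simp [hsc]⟩
    exact ⟨Equiv.ofBijective _ hbij, Finset.mem_univ _, rfl⟩

/-- `det (t - ξ / (2πi)) = ∑_k C_k(ξ, …, ξ) t^(m - k)`. -/
theorem det_eq_chernPoly (m : ℕ) (ξ : Mat m) (t : ℂ) :
    (t • (1 : Mat m) - (1 / (2 * Real.pi * Complex.I)) • ξ).det =
      ∑ k ∈ Finset.range (m + 1), chernPoly m k (fun _ => ξ) * t ^ (m - k) := by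
  set c : ℂ := 1 / (2 * Real.pi * Complex.I) with hc
  have h1 : (t • (1 : Mat m) - c • ξ).det = (c • ξ).charpoly.eval t := by
    rw [Matrix.eval_charpoly, Matrix.scalar_apply, Matrix.smul_one_eq_diagonal]
  have hdeg : (c • ξ).charpoly.natDegree = m := by
    rw [Matrix.charpoly_natDegree_eq_dim, Fintype.card_fin]
  rw [h1, Polynomial.eval_eq_sum_range, hdeg, ← Finset.sum_range_reflect]
  refine Finset.sum_congr rfl fun k hk => ?_
  have hk' : k ≤ m := by simpa [Nat.lt_succ_iff] using hk
  have e : m + 1 - 1 - k = m - k := by omega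
  rw [e]
  congr 1
  have h2 := Matrix.charpoly_coeff_eq_sum_minors (c • ξ) k (by simpa using hk')
  rw [Fintype.card_fin] at h2
  rw [h2, chernPoly_apply, ← hc]
  have h3 := sum_minors_eq m k (c • ξ)
  have hk0 : (k.factorial : ℂ) ≠ 0 := by exact_mod_cast k.factorial_ne_zero
  have h4 : ∑ f : Fin k → Fin m, ((c • ξ).submatrix f f).det = c ^ k *
      ∑ f : Fin k → Fin m, ∑ σ : Equiv.Perm (Fin k), ((Equiv.Perm.sign σ : ℤ) : ℂ) *
        ∏ i, ξ (f (σ i)) (f i) := by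
    rw [Finset.mul_sum]
    refine Finset.sum_congr rfl fun f _ => ?_
    rw [Matrix.submatrix_smul, Pi.smul_apply, Pi.smul_apply, Matrix.det_smul, Fintype.card_fin,
      Matrix.det_apply']
    simp
  rw [h4] at h3
  rw [neg_pow c k, mul_assoc, mul_assoc]
  congr 1
  rw [mul_left_comm, ← h3, inv_mul_cancel_left₀ hk0]

/-! ### Algebra of alternating forms -/

section Algebra

variable {T V W : Type*} [AddCommGroup T] [Module ℝ T] [TopologicalSpace T]

/-- The contracted wedge product `[α ∧ β]` of two matrix-valued `1`-forms:
`[α ∧ β](v, w) = [α v, β w] - [α w, β v]`, see `bracketWedge_apply`. -/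
def bracketWedge {m : ℕ} (α β : T [⋀^Fin 1]→L[ℝ] Mat m) : T [⋀^Fin 2]→L[ℝ] Mat m :=
  ContinuousMultilinearMap.alternatization
    { toFun := fun v => α (fun _ => v 0) * β (fun _ => v 1) - β (fun _ => v 1) * α (fun _ => v 0)
      map_update_add' := by
        intro _ v i x y
        have ha : ∀ (γ : T [⋀^Fin 1]→L[ℝ] Mat m) (a b : T),
            γ (fun _ => a + b) = γ (fun _ => a) + γ (fun _ => b) := fun γ a b =>
          ((ContinuousAlternatingMap.ofSubsingleton ℝ T (Mat m) (0 : Fin 1)).symm γ).map_add a b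
        fin_cases i <;> simp [ha, add_mul, mul_add] <;> abel
      map_update_smul' := by
        intro _ v i c x
        have ha : ∀ (γ : T [⋀^Fin 1]→L[ℝ] Mat m) (c : ℝ) (a : T),
            γ (fun _ => c • a) = c • γ (fun _ => a) := fun γ c a =>
          ((ContinuousAlternatingMap.ofSubsingleton ℝ T (Mat m) (0 : Fin 1)).symm γ).map_smul c a
        fin_cases i <;> simp [ha, smul_sub]
      cont := by
        have h1 : Continuous fun v : Fin 2 → T => α (fun _ => v 0) :=
          α.cont.comp (continuous_pi fun _ => continuous_apply 0)
        have h2 : Continuous fun v : Fin 2 → T => β (fun _ => v 1) :=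
          β.cont.comp (continuous_pi fun _ => continuous_apply 1)
        exact (h1.mul h2).sub (h2.mul h1) }

theorem bracketWedge_apply {m : ℕ} (α β : T [⋀^Fin 1]→L[ℝ] Mat m) (v : Fin 2 → T) :
    bracketWedge α β v =
      ⁅α (fun _ => v 0), β (fun _ => v 1)⁆ - ⁅α (fun _ => v 1), β (fun _ => v 0)⁆ := by
  have h : (Finset.univ : Finset (Equiv.Perm (Fin 2))) = {1, Equiv.swap 0 1} := by decide
  have h' : (1 : Equiv.Perm (Fin 2)) ≠ Equiv.swap 0 1 := by decide
  rw [bracketWedge, ContinuousMultilinearMap.alternatization_apply_apply, h,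
    Finset.sum_pair h', Equiv.Perm.sign_one, Equiv.Perm.sign_swap (by decide), one_smul,
    Units.neg_smul, one_smul, ← sub_eq_add_neg]
  rfl

variable [AddCommGroup V] [Module ℝ V] [TopologicalSpace V]
  [AddCommGroup W] [Module ℝ W] [TopologicalSpace W]

/-- The multilinear map `(v₁, …, v_{2k}) ↦ C(F(v₁, v₂), …, F(v_{2k-1}, v_{2k}))`. -/
def pairedMap {k : ℕ} (C : ContinuousMultilinearMap ℝ (fun _ : Fin k => V) W)
    (F : T [⋀^Fin 2]→L[ℝ] V) : ContinuousMultilinearMap ℝ (fun _ : Fin (2 * k) => T) W where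
  toMultilinearMap :=
    (C.toMultilinearMap.compMultilinearMap
      (fun _ : Fin k => F.toAlternatingMap.toMultilinearMap)).domDomCongr
      ((Equiv.sigmaEquivProd (Fin k) (Fin 2)).trans
        (finProdFinEquiv.trans (finCongr (mul_comm k 2))))
  cont := C.cont.comp (continuous_pi fun _ => F.cont.comp (continuous_pi fun _ =>
    continuous_apply _))

theorem pairedMap_apply {k : ℕ} (C : ContinuousMultilinearMap ℝ (fun _ : Fin k => V) W)
    (F : T [⋀^Fin 2]→L[ℝ] V) (v : Fin (2 * k) → T) :
    pairedMap C F v = C (fun i => F ![v ⟨2 * i, by omega⟩, v ⟨2 * i + 1, by omega⟩]) := by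
  change C _ = C _
  congr 1
  funext i
  change F _ = F _
  congr 1
  funext j
  fin_cases j
  · simp [Sigma.curry, Equiv.sigmaEquivProd, finProdFinEquiv]
  · simp [Sigma.curry, Equiv.sigmaEquivProd, finProdFinEquiv, add_comm]

variable [IsTopologicalAddGroup W] [ContinuousConstSMul ℝ W]

/-- The `2k`-form `C(F ∧ ⋯ ∧ F)` obtained from a `k`-linear map `C` and a vector-valued
`2`-form `F`, see `wedgePower_apply`. -/
def wedgePower {k : ℕ} (C : ContinuousMultilinearMap ℝ (fun _ : Fin k => V) W)
    (F : T [⋀^Fin 2]→L[ℝ] V) : T [⋀^Fin (2 * k)]→L[ℝ] W :=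
  ((2 : ℝ) ^ k)⁻¹ • ContinuousMultilinearMap.alternatization (pairedMap C F)

theorem wedgePower_apply {k : ℕ} (C : ContinuousMultilinearMap ℝ (fun _ : Fin k => V) W)
    (F : T [⋀^Fin 2]→L[ℝ] V) (v : Fin (2 * k) → T) :
    wedgePower C F v = ((2 : ℝ) ^ k)⁻¹ • ∑ σ : Equiv.Perm (Fin (2 * k)), Equiv.Perm.sign σ •
      C (fun i => F ![v (σ ⟨2 * i, by omega⟩), v (σ ⟨2 * i + 1, by omega⟩)]) := by
  rw [wedgePower, ContinuousAlternatingMap.smul_apply,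
    ContinuousMultilinearMap.alternatization_apply_apply]
  simp only [pairedMap_apply, Function.comp_apply]

end Algebra

/-! ### Differential forms on manifolds -/

section Forms

/-- Differential `k`-forms on the manifold `M` (modelled on `E`, without boundary) with values in
the vector space `F`, no regularity being required. -/
def DForm (E M F : Type*) [NormedAddCommGroup E] [NormedSpace ℝ E] [TopologicalSpace M]
    [ChartedSpace E M] [NormedAddCommGroup F] [NormedSpace ℝ F] (k : ℕ) : Type _ :=
  ∀ x : M, TangentSpace 𝓘(ℝ, E) x [⋀^Fin k]→L[ℝ] F

instance (E M F : Type*) [NormedAddCommGroup E] [NormedSpace ℝ E] [TopologicalSpace M]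
    [ChartedSpace E M] [NormedAddCommGroup F] [NormedSpace ℝ F] (k : ℕ) :
    AddCommGroup (DForm E M F k) :=
  inferInstanceAs (AddCommGroup (∀ x : M, TangentSpace 𝓘(ℝ, E) x [⋀^Fin k]→L[ℝ] F))

instance (E M F : Type*) [NormedAddCommGroup E] [NormedSpace ℝ E] [TopologicalSpace M]
    [ChartedSpace E M] [NormedAddCommGroup F] [NormedSpace ℝ F] (k : ℕ) :
    Module ℝ (DForm E M F k) :=
  inferInstanceAs (Module ℝ (∀ x : M, TangentSpace 𝓘(ℝ, E) x [⋀^Fin k]→L[ℝ] F))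

variable {E M F : Type*} [NormedAddCommGroup E] [NormedSpace ℝ E] [TopologicalSpace M]
  [ChartedSpace E M] [NormedAddCommGroup F] [NormedSpace ℝ F] {k : ℕ}

/-- The expression of a form in the chart `e`: its pullback along `e⁻¹`. -/
def localRep (e : OpenPartialHomeomorph M E) (α : DForm E M F k) : E → E [⋀^Fin k]→L[ℝ] F :=
  fun y => (α (e.symm y)).compContinuousLinearMap (mfderiv 𝓘(ℝ, E) 𝓘(ℝ, E) e.symm y)

theorem localRep_add (e : OpenPartialHomeomorph M E) (α β : DForm E M F k) :
    localRep e (α + β) = localRep e α + localRep e β := rfl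

theorem localRep_smul (e : OpenPartialHomeomorph M E) (c : ℝ) (α : DForm E M F k) :
    localRep e (c • α) = c • localRep e α := rfl

variable (E M F k) in
/-- `Ω^k(M, F)`: the smooth `k`-forms, those that are smooth in all the charts `chartAt x`. -/
def smoothForms : Submodule ℝ (DForm E M F k) where
  carrier := {α | ∀ x : M, ContDiffOn ℝ ∞ (localRep (chartAt E x) α) (chartAt E x).target}
  zero_mem' := fun x => by
    have : localRep (chartAt E x) (0 : DForm E M F k) = fun _ => 0 := rfl
    rw [this]
    exact contDiffOn_const
  add_mem' := fun {α β} hα hβ x => by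
    rw [localRep_add]
    exact (hα x).add (hβ x)
  smul_mem' := fun c α hα x => by
    rw [localRep_smul]
    exact (hα x).const_smul c

theorem differentiableAt_localRep (α : smoothForms E M F k) (x : M) :
    DifferentiableAt ℝ (localRep (chartAt E x) α.1) (chartAt E x x) :=
  (((α.2 x).contDiffAt ((chartAt E x).open_target.mem_nhds (mem_chart_target E x))).differentiableAt
    (by simp))

/-- The exterior derivative of smooth forms, computed at each point in a chart around it. -/
def extD : smoothForms E M F k →ₗ[ℝ] DForm E M F (k + 1) where
  toFun α := fun x => (extDeriv (localRep (chartAt E x) α.1) (chartAt E x x)).compContinuousLinearMap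
    (mfderiv 𝓘(ℝ, E) 𝓘(ℝ, E) (chartAt E x) x)
  map_add' α β := by
    funext x
    simp only [Submodule.coe_add, localRep_add]
    rw [extDeriv_add (differentiableAt_localRep α x) (differentiableAt_localRep β x)]
    rfl
  map_smul' c α := by
    funext x
    simp only [Submodule.coe_smul, localRep_smul, extDeriv_smul]
    rfl

variable {E' M' : Type*} [NormedAddCommGroup E'] [NormedSpace ℝ E'] [TopologicalSpace M']
  [ChartedSpace E' M']

/-- The pullback `f^* α` of a form along a map `f`. -/
def pullback (f : M → M') (α : DForm E' M' F k) : DForm E M F k :=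
  fun x => (α (f x)).compContinuousLinearMap (mfderiv 𝓘(ℝ, E) 𝓘(ℝ, E') f x)

end Forms

/-! ### De Rham cohomology -/

section Cohomology

variable {E X : Type*} [NormedAddCommGroup E] [NormedSpace ℝ E] [TopologicalSpace X]
  [ChartedSpace E X]

/-- The closed forms in a family `S` of spaces of smooth real forms. -/
def cocycles (S : ∀ k, Submodule ℝ (smoothForms E X ℝ k)) (k : ℕ) :
    Submodule ℝ (smoothForms E X ℝ k) :=
  S k ⊓ LinearMap.ker extD

/-- The exterior derivatives of the forms of the family `S`, in each degree. -/
def coboundaries (S : ∀ k, Submodule ℝ (smoothForms E X ℝ k)) :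
    ∀ k, Submodule ℝ (smoothForms E X ℝ k)
  | 0 => ⊥
  | k + 1 => ((S k).map extD).comap (smoothForms E X ℝ (k + 1)).subtype

/-- The cohomology of a subcomplex `S` of the de Rham complex of `X`: the closed forms of `S` modulo
the exterior derivatives of forms of `S`. -/
abbrev Cohomology (S : ∀ k, Submodule ℝ (smoothForms E X ℝ k)) (k : ℕ) : Type _ :=
  cocycles S k ⧸ (coboundaries S k).comap (cocycles S k).subtype

variable (E X) in
/-- The full de Rham complex `Ω^•(X)`. -/
abbrev deRhamComplex : ∀ k, Submodule ℝ (smoothForms E X ℝ k) := fun _ => ⊤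

/-- The subcomplex of the smooth forms `α` with `τ^* α = ε α`; for `ε = 1` and `ε = -1` these are
`Ω^•_+(X)` and `Ω^•_-(X)`. -/
def parityComplex (τ : X → X) (ε : ℝ) (k : ℕ) : Submodule ℝ (smoothForms E X ℝ k) where
  carrier := {α | pullback τ α.1 = ε • α.1}
  zero_mem' := by
    change pullback τ (0 : DForm E X ℝ k) = ε • (0 : DForm E X ℝ k)
    rw [smul_zero]
    rfl
  add_mem' := by
    intro α β hα hβ
    change pullback τ (α.1 + β.1) = ε • (α.1 + β.1)
    rw [smul_add, ← hα, ← hβ]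
    rfl
  smul_mem' := by
    intro c α hα
    change pullback τ (c • α.1) = ε • (c • α.1)
    rw [smul_comm, ← hα]
    rfl

/-- The de Rham class of a closed smooth form. -/
def deRhamClass {k : ℕ} (β : smoothForms E X ℝ k) (h : extD β = 0) :
    Cohomology (deRhamComplex E X) k :=
  Submodule.Quotient.mk ⟨β, Submodule.mem_top, h⟩

theorem cocycles_mono {S T : ∀ k, Submodule ℝ (smoothForms E X ℝ k)} (h : ∀ k, S k ≤ T k) (k : ℕ) :
    cocycles S k ≤ cocycles T k := inf_le_inf_right _ (h k)

theorem coboundaries_mono {S T : ∀ k, Submodule ℝ (smoothForms E X ℝ k)} (h : ∀ k, S k ≤ T k) :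
    ∀ k, coboundaries S k ≤ coboundaries T k
  | 0 => le_rfl
  | k + 1 => Submodule.comap_mono (Submodule.map_mono (h k))

/-- The map `H^k_{dR,±}(X) → H^k_dR(X)` induced by the inclusion of forms. -/
def parityIncl (τ : X → X) (ε : ℝ) (k : ℕ) :
    Cohomology (parityComplex (E := E) τ ε) k →ₗ[ℝ] Cohomology (deRhamComplex E X) k :=
  Submodule.mapQ _ _ (Submodule.inclusion (cocycles_mono (fun _ => le_top) k))
    (fun _ hα => coboundaries_mono (fun _ => le_top) k hα)

end Cohomology

/-! ### Principal `U(m)`-bundles, "Real" structures and connections -/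

/-- A smooth principal `U(m)`-bundle with total space `P` and base `X`. -/
structure PrincipalUBundle (m : ℕ) (E X EP P : Type*) [NormedAddCommGroup E] [NormedSpace ℝ E]
    [TopologicalSpace X] [ChartedSpace E X] [NormedAddCommGroup EP] [NormedSpace ℝ EP]
    [TopologicalSpace P] [ChartedSpace EP P] where
  /-- the bundle projection -/
  proj : P → X
  /-- the right action `R_u(p) = p u` -/
  act : P → U m → P
  contMDiff_proj : ContMDiff 𝓘(ℝ, EP) 𝓘(ℝ, E) ∞ proj
  act_one : ∀ p, act p 1 = p
  act_mul : ∀ p u v, act p (u * v) = act (act p u) v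
  contMDiff_act : ContMDiff (𝓘(ℝ, EP).prod 𝓘(ℝ, uLie m)) 𝓘(ℝ, EP) ∞
    (fun q : P × U m => act q.1 q.2)
  /-- each fibre is an orbit -/
  fibre_orbit : ∀ x, ∃ p, proj ⁻¹' {x} = Set.range (act p)
  /-- local triviality: over an open neighbourhood `V` of each point, `p ↦ (π p, h p)` is an
  equivariant diffeomorphism of `π⁻¹(V)` onto `V × U(m)`, with inverse `s` -/
  locally_trivial : ∀ x₀, ∃ V : Set X, IsOpen V ∧ x₀ ∈ V ∧ ∃ (h : P → U m) (s : X × U m → P),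
    ContMDiffOn 𝓘(ℝ, EP) 𝓘(ℝ, uLie m) ∞ h (proj ⁻¹' V) ∧
    ContMDiffOn (𝓘(ℝ, E).prod 𝓘(ℝ, uLie m)) 𝓘(ℝ, EP) ∞ s (V ×ˢ Set.univ) ∧
    (∀ p, proj p ∈ V → s (proj p, h p) = p) ∧
    (∀ x ∈ V, ∀ u, proj (s (x, u)) = x ∧ h (s (x, u)) = u) ∧
    (∀ p, proj p ∈ V → ∀ u, h (act p u) = h p * u)

/-- The exponential map `ξ ↦ e^ξ` from `𝔲(m)` to `U(m)`. -/
def expU {m : ℕ} (ξ : uLie m) : U m :=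
  ⟨NormedSpace.exp (ξ : Mat m), by
    let _ : NormedAlgebra ℚ (Mat m) := NormedAlgebra.restrictScalars ℚ ℂ (Mat m)
    exact NormedSpace.exp_mem_unitary_of_mem_skewAdjoint ξ.2⟩

/-- The entrywise complex conjugate of a unitary matrix. -/
def conjU {m : ℕ} (u : U m) : U m :=
  ⟨(u : Mat m).map (starRingEnd ℂ), by
    rw [Matrix.mem_unitaryGroup_iff]
    have h : (u : Mat m) * star (u : Mat m) = 1 := Matrix.mem_unitaryGroup_iff.1 u.2
    have h2 : star ((u : Mat m).map (starRingEnd ℂ)) =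
        (star (u : Mat m)).map (starRingEnd ℂ) := by
      ext i j
      simp [Matrix.star_apply]
    rw [h2, ← Matrix.map_mul, h, Matrix.map_one _ (map_zero _) (map_one _)]⟩

namespace PrincipalUBundle

variable {m : ℕ} {E X EP P : Type*} [NormedAddCommGroup E] [NormedSpace ℝ E]
  [TopologicalSpace X] [ChartedSpace E X] [NormedAddCommGroup EP] [NormedSpace ℝ EP]
  [TopologicalSpace P] [ChartedSpace EP P] (B : PrincipalUBundle m E X EP P)

/-- The fundamental vector field of `ξ`: the velocity at `t = 0` of `t ↦ p e^{tξ}`. -/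
def fundamental (ξ : uLie m) (p : P) : TangentSpace 𝓘(ℝ, EP) p :=
  (mfderiv 𝓘(ℝ, ℝ) 𝓘(ℝ, EP) (fun t : ℝ => B.act p (expU (t • ξ))) 0 : ℝ →L[ℝ] EP) 1

/-- A "Real" structure on `B`, over the involution `τ` of the base. -/
structure RealStructure (τ : X → X) where
  /-- the lift of `τ` to the total space -/
  toFun : P → P
  contMDiff_toFun : ContMDiff 𝓘(ℝ, EP) 𝓘(ℝ, EP) ∞ toFun
  equivariant : ∀ p, B.proj (toFun p) = τ (B.proj p)
  involutive : ∀ p, toFun (toFun p) = p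
  real_act : ∀ p u, toFun (B.act p u) = B.act (toFun p) (conjU u)

/-- A connection `1`-form `ω ∈ Ω^1(P, 𝔲(m))`. -/
structure Connection where
  /-- the `1`-form -/
  form : smoothForms EP P (Mat m) 1
  mem_uLie : ∀ p v, form.1 p v ∈ uLie m
  vertical : ∀ p (ξ : uLie m), form.1 p (fun _ => B.fundamental ξ p) = (ξ : Mat m)
  equivariant : ∀ (u : U m) p v,
    pullback (fun q => B.act q u) form.1 p v = ((u⁻¹ : U m) : Mat m) * form.1 p v * (u : Mat m)

variable {B}

/-- A connection is "Real" if `Θ^* (conj ω) = ω`. -/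
def Connection.IsReal {τ : X → X} (A : B.Connection) (Θ : B.RealStructure τ) : Prop :=
  ∀ p v, (pullback (E := EP) Θ.toFun A.form.1 p v).map (starRingEnd ℂ) = A.form.1 p v

/-- The curvature `F_ω = dω + ½ [ω ∧ ω]`. -/
def Connection.curvature (A : B.Connection) : DForm EP P (Mat m) 2 :=
  fun p => extD A.form p + (1 / 2 : ℝ) • bracketWedge (A.form.1 p) (A.form.1 p)

/-- The `2k`-form `C_k(F_ω ∧ ⋯ ∧ F_ω)` on the total space. -/
def Connection.totalChernForm (A : B.Connection) (k : ℕ) : DForm EP P ℂ (2 * k) :=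
  fun p => wedgePower (chernPoly m k) (A.curvature p)

/-- The real `2k`-form `η` on the base is the `k`-th Chern form of `ω`:
`π^* η = C_k(F_ω ∧ ⋯ ∧ F_ω)`. -/
def Connection.IsChernForm (A : B.Connection) (k : ℕ) (η : smoothForms E X ℝ (2 * k)) : Prop :=
  ∀ p v, ((pullback B.proj η.1 p v : ℝ) : ℂ) = A.totalChernForm k p v

end PrincipalUBundle

end

end RealChernWeil

open RealChernWeil

namespace RealChernWeil

noncomputable section

/-! ### Invariance and reality of the Chern polynomials -/

/-! This is the Chern–Weil construction combined with the symmetry of a "Real" connection.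

Over an open set with a local section `s`, every point is `p = s(π p) h(p)`. Equivariance and
verticality then give `ω = h⁻¹ (s ∘ π)^*ω h + h⁻¹ dh`, so the curvature satisfies `F = h⁻¹ (s ∘
π)^*F h`. Since `C_k` is invariant under conjugation (`chernPoly_conj_invariant`), `C_k(F ∧ ⋯ ∧ F) =
π^* s^* C_k(F ∧ ⋯ ∧ F)`. As `π^*` is injective on forms, the local forms `s^* C_k(F ∧ ⋯ ∧ F)` do not
depend on `s`; they glue to the unique form on the base (`exists_pullback_proj_eq`). It is real
because `F` is anti-Hermitian and the factor `(1 / (2πi))^k` compensates for the sign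
(`conj_totalChernForm`).

Closedness holds on `P` (`extDeriv_chernForm_eq_zero`): infinitesimal invariance of `C_k` turns
derivatives of `F` into covariant ones, and the Bianchi identity makes their alternating sum vanish.
It descends by injectivity of `π^*`.

For the parity, `Θ^*ω = conj ω` yields `Θ^*F = conj F`. Because `C_k` has the factor `(1 /
(2πi))^k`, `C_k(conj F) = (-1)^k conj C_k(F) = (-1)^k C_k(F)`. With `π ∘ Θ = τ ∘ π` this becomes
`τ^* = (-1)^k` on the Chern form. Finally, averaging a primitive over `τ` shows that the cohomology
of each parity complex injects into de Rham cohomology (`parityIncl_injective`), which gives the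
uniqueness of the lifted class. -/

/-- For fixed `σ` the sum over `f` is a product of traces along the cycles of `σ`, so a factor `g`
may be moved around each cycle. No invertibility of `g` is needed, which allows differentiation in
`g` later. -/
theorem chernPoly_mul_comm (m k : ℕ) (A : Fin k → Mat m) (g : Mat m) :
    chernPoly m k (fun i => A i * g) = chernPoly m k (fun i => g * A i) := by
  rw [chernPoly_apply, chernPoly_apply, Finset.sum_comm]
  conv_rhs => rw [Finset.sum_comm]
  congr 1
  refine Finset.sum_congr rfl fun σ _ => ?_
  rw [← Finset.mul_sum, ← Finset.mul_sum]
  congr 1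
  simp only [Matrix.mul_apply, Finset.prod_univ_sum, Fintype.piFinset_univ]
  rw [Finset.sum_comm]
  refine Finset.sum_congr rfl fun b _ => ?_
  -- The intermediate index on the right is `f ∘ σ`, and the intermediate index `b` on the left
  -- takes the role of `f` there.
  refine Fintype.sum_equiv (Equiv.arrowCongr σ⁻¹ (Equiv.refl _)) _ _ fun f => ?_
  have h : ∀ i, (Equiv.arrowCongr σ⁻¹ (Equiv.refl (Fin m))) f i = f (σ i) := fun i => rfl
  simp only [h, Finset.prod_mul_distrib]
  rw [Equiv.prod_comp σ (fun i => g (b i) (f i)), mul_comm]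

theorem chernPoly_conj_invariant (m k : ℕ) (A : Fin k → Mat m) {g h : Mat m} (hgh : g * h = 1) :
    chernPoly m k (fun i => h * A i * g) = chernPoly m k A := by
  rw [chernPoly_mul_comm m k (fun i => h * A i) g]
  simp only [← mul_assoc, hgh, one_mul]

/-- Transposing reverses the cycles: replace `σ` by `σ⁻¹`, which has the same sign, and `f` by `f ∘
σ`. -/
theorem chernPoly_transpose (m k : ℕ) (A : Fin k → Mat m) :
    chernPoly m k (fun i => (A i).transpose) = chernPoly m k A := by
  rw [chernPoly_apply, chernPoly_apply, Finset.sum_comm]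
  conv_rhs => rw [Finset.sum_comm]
  congr 1
  refine Fintype.sum_equiv (Equiv.inv _) _ _ fun σ => ?_
  refine Fintype.sum_equiv (Equiv.arrowCongr σ⁻¹ (Equiv.refl _)) _ _ fun f => ?_
  have h : ∀ i, (Equiv.arrowCongr σ⁻¹ (Equiv.refl (Fin m))) f i = f (σ i) := fun i => rfl
  simp [h]

/-- The only non-real coefficient is the `k`-th power of the purely imaginary `-1 / (2πi)`; this is
the source of the sign in the theorem. -/
theorem conj_chernPoly (m k : ℕ) (A : Fin k → Mat m) :
    starRingEnd ℂ (chernPoly m k A) =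
      (-1) ^ k * chernPoly m k (fun i => (A i).map (starRingEnd ℂ)) := by
  rw [chernPoly_apply, chernPoly_apply]
  simp only [map_mul, map_sum, map_prod, map_pow, map_neg, map_div₀, map_one, map_inv₀,
    Complex.conj_I, Complex.conj_ofReal, map_natCast, map_intCast, map_ofNat, Matrix.map_apply]
  rw [← mul_assoc, ← mul_assoc, ← mul_pow]
  congr 3
  simp

/-- For anti-Hermitian matrices `conj A = -Aᵀ`, so a second factor `(-1)^k` cancels the one of
`conj_chernPoly`. -/
theorem conj_chernPoly_of_mem (m k : ℕ) (A : Fin k → Mat m) (hA : ∀ i, A i ∈ uLie m) :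
    starRingEnd ℂ (chernPoly m k A) = chernPoly m k A := by
  have h1 : (fun i => (A i).map (starRingEnd ℂ)) = fun i => (-1 : ℝ) • (A i).transpose := by
    funext i
    have h : star (A i) = - A i := hA i
    ext a b
    have := congrFun (congrFun h b) a
    simpa [Matrix.star_apply] using this
  rw [conj_chernPoly, h1, ContinuousMultilinearMap.map_smul_univ, chernPoly_transpose]
  simp [← mul_assoc, ← mul_pow]

/-- Infinitesimal invariance: differentiate `C(Aᵢ (1 + tB)) = C((1 + tB) Aᵢ)` at `t = 0`. -/
theorem sum_chernPoly_commutator (m k : ℕ) (A : Fin k → Mat m) (B : Mat m) :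
    ∑ j, chernPoly m k (Function.update A j (A j * B - B * A j)) = 0 := by
  have key : ∀ D : Fin k → Mat m, HasDerivAt (fun t : ℝ => chernPoly m k (fun i => A i + t • D i))
      (∑ j, chernPoly m k (Function.update A j (D j))) 0 := by
    intro D
    have h1 : HasDerivAt (fun t : ℝ => (fun i => A i + t • D i)) D 0 := by
      rw [hasDerivAt_pi]
      intro i
      simpa using ((hasDerivAt_id (0 : ℝ)).smul_const (D i)).const_add (A i)
    have h2 := (chernPoly m k).hasFDerivAt (fun i => A i + (0 : ℝ) • D i)
    have h3 := HasFDerivAt.comp_hasDerivAt (0 : ℝ) h2 h1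
    simp only [zero_smul, add_zero, ContinuousMultilinearMap.linearDeriv_apply] at h3
    exact h3
  have h1 := key (fun i => A i * B)
  have h2 := key (fun i => B * A i)
  have h3 : (fun t : ℝ => chernPoly m k (fun i => A i + t • (A i * B))) =
      fun t : ℝ => chernPoly m k (fun i => A i + t • (B * A i)) := by
    funext t
    have := chernPoly_mul_comm m k A (1 + t • B)
    simpa [mul_add, add_mul] using this
  rw [h3] at h1
  have h4 := h1.unique h2
  simp only [ContinuousMultilinearMap.map_update_sub, Finset.sum_sub_distrib, h4, sub_self]

/-! ### Smoothness of functions with values in alternating maps -/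

section AltSmooth

variable {G E E' F : Type*} [NormedAddCommGroup G] [NormedSpace ℝ G]
  [NormedAddCommGroup E] [NormedSpace ℝ E] [NormedAddCommGroup E'] [NormedSpace ℝ E']
  [NormedAddCommGroup F] [NormedSpace ℝ F] {k : ℕ} {n : WithTop ℕ∞}

theorem finiteDimensional_continuousAlternatingMap [FiniteDimensional ℝ E]
    [FiniteDimensional ℝ F] : FiniteDimensional ℝ (E [⋀^Fin k]→L[ℝ] F) := by
  let L : (E [⋀^Fin k]→L[ℝ] F) →ₗ[ℝ] MultilinearMap ℝ (fun _ : Fin k => E) F :=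
    { toFun := fun α => α.toMultilinearMap
      map_add' := fun _ _ => rfl
      map_smul' := fun _ _ => rfl }
  refine FiniteDimensional.of_injective L fun α β h => ?_
  ext v
  exact congrArg (fun f : MultilinearMap ℝ (fun _ : Fin k => E) F => f v) h

/-- Evaluation on tuples of basis vectors embeds the alternating maps linearly into a finite product
of copies of `F`; a linear left inverse is continuous in finite dimension and recovers `f` from its
values. -/
theorem contDiffAt_alternating_iff [FiniteDimensional ℝ E] [FiniteDimensional ℝ F]
    {f : G → E [⋀^Fin k]→L[ℝ] F} {x : G} :
    ContDiffAt ℝ n f x ↔ ∀ v, ContDiffAt ℝ n (fun y => f y v) x := by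
  constructor
  · intro h v
    exact (ContinuousAlternatingMap.apply ℝ E F v).contDiff.contDiffAt.comp x h
  · intro h
    have := finiteDimensional_continuousAlternatingMap (E := E) (F := F) (k := k)
    let b := Module.finBasis ℝ E
    let L : (E [⋀^Fin k]→L[ℝ] F) →ₗ[ℝ] ((Fin k → Fin (Module.finrank ℝ E)) → F) :=
      LinearMap.pi fun i => (ContinuousAlternatingMap.apply ℝ E F (fun j => b (i j))).toLinearMap
    have hL : LinearMap.ker L = ⊥ := by
      rw [LinearMap.ker_eq_bot]
      intro α β hαβ
      apply ContinuousAlternatingMap.toAlternatingMap_injective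
      refine Module.Basis.ext_alternating b fun i _ => ?_
      exact congrFun hαβ i
    obtain ⟨R, hR⟩ := L.exists_leftInverse_of_injective hL
    have h1 : ContDiffAt ℝ n (fun y => L (f y)) x := contDiffAt_pi.2 fun i => h _
    have h2 := (LinearMap.toContinuousLinearMap R).contDiff.contDiffAt.comp x h1
    refine h2.congr_of_eventuallyEq (Filter.Eventually.of_forall fun y => ?_)
    exact (LinearMap.congr_fun hR (f y)).symm

theorem contDiffAt_alternating_compCLM [FiniteDimensional ℝ E] [FiniteDimensional ℝ F]
    {f : G → E' [⋀^Fin k]→L[ℝ] F} {L : G → E →L[ℝ] E'} {x : G} (hf : ContDiffAt ℝ n f x)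
    (hL : ContDiffAt ℝ n L x) :
    ContDiffAt ℝ n (fun y => (f y).compContinuousLinearMap (L y)) x := by
  rw [contDiffAt_alternating_iff]
  intro v
  have h1 : ContDiffAt ℝ n (fun y => (f y).toContinuousMultilinearMap) x :=
    (ContinuousAlternatingMap.toContinuousMultilinearMapLI (𝕜 := ℝ) (E := E') (F := F)
      (ι := Fin k)).toContinuousLinearMap.contDiff.contDiffAt.comp x hf
  have h2 : ContDiffAt ℝ n (fun y =>
      ContinuousMultilinearMap.compContinuousLinearMapContinuousMultilinear ℝ
        (fun _ : Fin k => E) (fun _ => E') F (fun _ => L y)) x :=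
    (ContinuousMultilinearMap.contDiff _).contDiffAt.comp x (contDiffAt_pi.2 fun _ => hL)
  have h3 := h2.clm_apply h1
  exact (ContinuousMultilinearMap.apply ℝ (fun _ : Fin k => E) F v).contDiff.contDiffAt.comp x h3

theorem contDiffAt_wedgePower {V : Type*} [NormedAddCommGroup V] [NormedSpace ℝ V]
    [FiniteDimensional ℝ E] [FiniteDimensional ℝ F]
    (C : ContinuousMultilinearMap ℝ (fun _ : Fin k => V) F)
    {f : G → E [⋀^Fin 2]→L[ℝ] V} {x : G} (hf : ContDiffAt ℝ n f x) :
    ContDiffAt ℝ n (fun y => wedgePower C (f y)) x := by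
  rw [contDiffAt_alternating_iff]
  intro v
  simp only [wedgePower_apply]
  refine contDiffAt_const.smul (ContDiffAt.sum fun σ _ => ?_)
  refine ContDiffAt.const_smul _ ?_
  refine C.contDiff.contDiffAt.comp x (contDiffAt_pi.2 fun i => ?_)
  exact (ContinuousAlternatingMap.apply ℝ E V _).contDiff.contDiffAt.comp x hf

theorem contDiffAt_extDeriv {f : E → E [⋀^Fin k]→L[ℝ] F} {x : E} (hf : ContDiffAt ℝ ∞ f x) :
    ContDiffAt ℝ ∞ (extDeriv f) x :=
  ContDiffAt.comp (g := ContinuousAlternatingMap.alternatizeUncurryFinCLM (n := k) ℝ E F) x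
    (ContinuousLinearMap.contDiff _).contDiffAt (hf.fderiv_right (m := ∞) (by simp))

end AltSmooth

/-! ### Matrix-valued `1`-forms on a vector space and their curvature -/

section VectorSpace

variable {E : Type*} [NormedAddCommGroup E] [NormedSpace ℝ E] {m : ℕ}

/-- The curvature `dw + ½ [w ∧ w]` of a matrix-valued `1`-form on a vector space. -/
def flatCurvature (w : E → E [⋀^Fin 1]→L[ℝ] Mat m) (y : E) : E [⋀^Fin 2]→L[ℝ] Mat m :=
  extDeriv w y + (1 / 2 : ℝ) • bracketWedge (w y) (w y)

theorem half_bracketWedge_apply {T : Type*} [AddCommGroup T] [Module ℝ T] [TopologicalSpace T]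
    (α : T [⋀^Fin 1]→L[ℝ] Mat m) (v : Fin 2 → T) :
    ((1 / 2 : ℝ) • bracketWedge α α) v =
      α (fun _ => v 0) * α (fun _ => v 1) - α (fun _ => v 1) * α (fun _ => v 0) := by
  rw [ContinuousAlternatingMap.smul_apply, bracketWedge_apply, Ring.lie_def, Ring.lie_def,
    sub_sub_sub_comm, ← sub_eq_zero]
  module

theorem extDeriv_oneForm_apply {F : Type*} [NormedAddCommGroup F] [NormedSpace ℝ F]
    (w : E → E [⋀^Fin 1]→L[ℝ] F) (y : E) (v : Fin 2 → E) :
    extDeriv w y v = fderiv ℝ w y (v 0) (fun _ => v 1) - fderiv ℝ w y (v 1) (fun _ => v 0) := by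
  rw [extDeriv, ContinuousAlternatingMap.alternatizeUncurryFin_apply, Fin.sum_univ_two]
  have h0 : (0 : Fin 2).removeNth v = fun _ => v 1 := by
    funext i; fin_cases i; rfl
  have h1 : (1 : Fin 2).removeNth v = fun _ => v 0 := by
    funext i; fin_cases i; rfl
  rw [h0, h1]
  simp [sub_eq_add_neg]

theorem flatCurvature_apply (w : E → E [⋀^Fin 1]→L[ℝ] Mat m) (y : E) (v : Fin 2 → E) :
    flatCurvature w y v =
      fderiv ℝ w y (v 0) (fun _ => v 1) - fderiv ℝ w y (v 1) (fun _ => v 0) +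
      (w y (fun _ => v 0) * w y (fun _ => v 1) - w y (fun _ => v 1) * w y (fun _ => v 0)) := by
  rw [flatCurvature, ContinuousAlternatingMap.add_apply, half_bracketWedge_apply,
    extDeriv_oneForm_apply]

theorem contDiffAt_oneForm_apply {F : Type*} [NormedAddCommGroup F] [NormedSpace ℝ F] {k : ℕ}
    {n : WithTop ℕ∞} {w : E → E [⋀^Fin k]→L[ℝ] F} {x : E} (h : ContDiffAt ℝ n w x)
    (v : Fin k → E) : ContDiffAt ℝ n (fun y => w y v) x :=
  (ContinuousAlternatingMap.apply ℝ E F v).contDiff.contDiffAt.comp x h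

theorem contDiffAt_flatCurvature [FiniteDimensional ℝ E] {w : E → E [⋀^Fin 1]→L[ℝ] Mat m} {x : E}
    (hw : ContDiffAt ℝ ∞ w x) : ContDiffAt ℝ ∞ (flatCurvature w) x := by
  refine (contDiffAt_extDeriv hw).add ?_
  rw [contDiffAt_alternating_iff]
  intro v
  simp only [half_bracketWedge_apply]
  exact ((contDiffAt_oneForm_apply hw _).mul (contDiffAt_oneForm_apply hw _)).sub
    ((contDiffAt_oneForm_apply hw _).mul (contDiffAt_oneForm_apply hw _))

theorem fderiv_alternating_apply {F : Type*} [NormedAddCommGroup F] [NormedSpace ℝ F] {k : ℕ}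
    {w : E → E [⋀^Fin k]→L[ℝ] F} {x : E} (h : DifferentiableAt ℝ w x) (v : Fin k → E) (a : E) :
    fderiv ℝ (fun y => w y v) x a = fderiv ℝ w x a v := by
  have := ((ContinuousAlternatingMap.apply ℝ E F v).hasFDerivAt (x := w x)).comp x h.hasFDerivAt
  exact congrArg (fun L : E →L[ℝ] F => L a) this.fderiv

/-- The curvature of a gauge transform. -/
theorem flatCurvature_gauge {w W : E → E [⋀^Fin 1]→L[ℝ] Mat m} {g h : E → Mat m} {x : E}
    (hw : DifferentiableAt ℝ w x) (hW : DifferentiableAt ℝ W x)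
    (hg : ContDiffAt ℝ 2 g x) (hh : DifferentiableAt ℝ h x) (hhg : ∀ᶠ y in nhds x, h y * g y = 1)
    (hwW : ∀ᶠ y in nhds x, ∀ v, w y (fun _ => v) = h y * W y (fun _ => v) * g y +
      h y * fderiv ℝ g y v) (v : Fin 2 → E) :
    flatCurvature w x v = h x * flatCurvature W x v * g x := by
  have hgd : DifferentiableAt ℝ g x := hg.differentiableAt (by simp)
  have hg2 : DifferentiableAt ℝ (fderiv ℝ g) x :=
    (hg.fderiv_right (m := 1) (by norm_num)).differentiableAt (by simp)
  have hHG : h x * g x = 1 := hhg.self_of_nhds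
  have hGH : g x * h x = 1 := mul_eq_one_comm.1 hHG
  have hGH' : ∀ Z, g x * (h x * Z) = Z := fun Z => by rw [← mul_assoc, hGH, one_mul]
  -- The derivative of an inverse, read off from differentiating `h g = 1`.
  have hdh : ∀ a, fderiv ℝ h x a = -(h x * fderiv ℝ g x a * h x) := by
    intro a
    have h1 : HasFDerivAt (fun y => h y * g y)
        (h x • fderiv ℝ g x + (fderiv ℝ h x).smulRight (g x)) x := by
      have := hh.hasFDerivAt.mul' hgd.hasFDerivAt
      exact this
    have h2 : HasFDerivAt (fun y => h y * g y) (0 : E →L[ℝ] Mat m) x :=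
      (hasFDerivAt_const (1 : Mat m) x).congr_of_eventuallyEq hhg
    have h3 := congrArg (fun L : E →L[ℝ] Mat m => L a * h x) (h1.unique h2)
    simp [add_mul, mul_assoc, hGH] at h3
    rw [mul_assoc]
    exact eq_neg_of_add_eq_zero_right h3
  -- Symmetry removes the second derivatives of `g` once the expression is antisymmetrized.
  have hsym : ∀ a b, fderiv ℝ (fderiv ℝ g) x a b = fderiv ℝ (fderiv ℝ g) x b a :=
    fun a b => (hg.isSymmSndFDerivAt (by simp)) a b
  have hdw : ∀ a b, fderiv ℝ w x a (fun _ => b) =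
      -(h x * fderiv ℝ g x a * h x) * W x (fun _ => b) * g x +
      h x * fderiv ℝ W x a (fun _ => b) * g x + h x * W x (fun _ => b) * fderiv ℝ g x a +
      -(h x * fderiv ℝ g x a * h x) * fderiv ℝ g x b + h x * fderiv ℝ (fderiv ℝ g) x a b := by
    intro a b
    rw [← fderiv_alternating_apply hw]
    have h1 : (fun y => w y (fun _ => b)) =ᶠ[nhds x]
        fun y => h y * W y (fun _ => b) * g y + h y * fderiv ℝ g y b := by
      filter_upwards [hwW] with y hy using hy b
    rw [h1.fderiv_eq]
    have h2 : DifferentiableAt ℝ (fun y => W y (fun _ => b)) x :=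
      DifferentiableAt.comp (g := ContinuousAlternatingMap.apply ℝ E (Mat m) (fun _ => b)) x
        (ContinuousLinearMap.differentiableAt _) hW
    have h3 : HasFDerivAt (fun y => fderiv ℝ g y b)
        ((ContinuousLinearMap.apply ℝ (Mat m) b).comp (fderiv ℝ (fderiv ℝ g) x)) x :=
      (ContinuousLinearMap.apply ℝ (Mat m) b).hasFDerivAt.comp x hg2.hasFDerivAt
    have h4 := ((hh.hasFDerivAt.mul' h2.hasFDerivAt).mul' hgd.hasFDerivAt).add
      (hh.hasFDerivAt.mul' h3)
    have h5 := h4.fderiv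
    refine (congrArg (fun L : E →L[ℝ] Mat m => L a) h5).trans ?_
    simp [fderiv_alternating_apply hW, hdh]
    noncomm_ring
  have hw0 := hwW.self_of_nhds
  rw [flatCurvature_apply, flatCurvature_apply, hdw, hdw, hw0, hw0, hsym (v 1) (v 0)]
  simp only [mul_add, add_mul, mul_sub, sub_mul, mul_assoc, hGH', neg_mul]
  abel

end VectorSpace

/-! ### The Bianchi identity and closedness of the Chern forms -/

section Closed

/-- A signed sum over all permutations of the arguments vanishes if the cyclic sums over three
of the positions do. -/
theorem sum_sign_smul_eq_zero_of_cyclic {ι T W : Type*} [Fintype ι] [DecidableEq ι]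
    [AddCommGroup W] [Module ℝ W] (Φ : (ι → T) → W) (c : Equiv.Perm ι)
    (hc : Equiv.Perm.sign c = 1) (h : ∀ v, Φ v + Φ (v ∘ c) + Φ (v ∘ c ∘ c) = 0) (v : ι → T) :
    ∑ ρ : Equiv.Perm ι, Equiv.Perm.sign ρ • Φ (v ∘ ρ) = 0 := by
  -- Right translation by an even permutation does not change the signed sum. Using it for `1`, `c`
  -- and `c * c`, three times the sum is a signed sum of the vanishing cyclic sums.
  have h1 : ∀ d : Equiv.Perm ι, Equiv.Perm.sign d = 1 →
      ∑ ρ : Equiv.Perm ι, Equiv.Perm.sign ρ • Φ (v ∘ ρ ∘ d) =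
        ∑ ρ : Equiv.Perm ι, Equiv.Perm.sign ρ • Φ (v ∘ ρ) := by
    intro d hd
    refine Fintype.sum_equiv (Equiv.mulRight d) _ _ fun ρ => ?_
    simp [hd, Equiv.Perm.coe_mul]
  have h2 := h1 (c * c) (by rw [Equiv.Perm.sign_mul, hc, one_mul])
  have h3 : (3 : ℝ) • ∑ ρ : Equiv.Perm ι, Equiv.Perm.sign ρ • Φ (v ∘ ρ) = 0 := by
    rw [show (3 : ℝ) = 1 + 1 + 1 by norm_num, add_smul, add_smul, one_smul]
    conv_lhs =>
      congr
      · rhs; rw [← h1 c hc]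
      · rw [← h2]
    rw [← Finset.sum_add_distrib, ← Finset.sum_add_distrib]
    refine Finset.sum_eq_zero fun ρ _ => ?_
    rw [← smul_add, ← smul_add]
    have := h (v ∘ ρ)
    rw [Equiv.Perm.coe_mul]
    exact (congrArg (fun z => Equiv.Perm.sign ρ • z) this).trans (smul_zero _)
  exact (smul_eq_zero.1 h3).resolve_left (by norm_num)

/-- All `n!` summands equal `Q v`. Antisymmetrizing a form that is already alternating lets each
term of its expansion be treated separately by `sum_sign_smul_eq_zero_of_cyclic`. -/
theorem eq_zero_of_sum_sign_smul {n : ℕ} {E F : Type*} [NormedAddCommGroup E] [NormedSpace ℝ E]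
    [NormedAddCommGroup F] [NormedSpace ℝ F] (Q : E [⋀^Fin n]→L[ℝ] F)
    (h : ∀ v, ∑ ρ : Equiv.Perm (Fin n), Equiv.Perm.sign ρ • Q (v ∘ ρ) = 0) : Q = 0 := by
  ext v
  have h1 : ∀ ρ : Equiv.Perm (Fin n), Equiv.Perm.sign ρ • Q (v ∘ ρ) = Q v := by
    intro ρ
    have h2 : Q (v ∘ ρ) = Equiv.Perm.sign ρ • Q v := Q.toAlternatingMap.map_perm v ρ
    rw [h2, smul_smul, Int.units_mul_self, one_smul]
  have h3 := h v
  rw [Finset.sum_congr rfl fun ρ _ => h1 ρ, Finset.sum_const, ← Nat.cast_smul_eq_nsmul ℝ] at h3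
  refine (smul_eq_zero.1 h3).resolve_left ?_
  rw [Finset.card_univ]
  exact_mod_cast Fintype.card_ne_zero

variable {E : Type*} [NormedAddCommGroup E] [NormedSpace ℝ E] {m : ℕ}

/-- The covariant derivative `D_a F (b, c) - [F (b, c), w a]` of the curvature. -/
def covariantDeriv (w : E → E [⋀^Fin 1]→L[ℝ] Mat m) (x a : E) (v : Fin 2 → E) : Mat m :=
  fderiv ℝ (flatCurvature w) x a v -
    (flatCurvature w x v * w x (fun _ => a) - w x (fun _ => a) * flatCurvature w x v)

/-- The Bianchi identity. -/
theorem covariantDeriv_cyclic [FiniteDimensional ℝ E] {w : E → E [⋀^Fin 1]→L[ℝ] Mat m} {x : E}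
    (hw : ContDiffAt ℝ ∞ w x) (a b c : E) :
    covariantDeriv w x a ![b, c] + covariantDeriv w x b ![c, a] + covariantDeriv w x c ![a, b] =
      0 := by
  have hwd : DifferentiableAt ℝ w x := hw.differentiableAt (by simp)
  have hFd : DifferentiableAt ℝ (flatCurvature w) x :=
    (contDiffAt_flatCurvature hw).differentiableAt (by simp)
  have hed : DifferentiableAt ℝ (extDeriv w) x :=
    (contDiffAt_extDeriv hw).differentiableAt (by simp)
  have hD : ∀ a b c, fderiv ℝ (flatCurvature w) x a ![b, c] =
      fderiv ℝ (extDeriv w) x a ![b, c] +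
      (fderiv ℝ w x a (fun _ => b) * w x (fun _ => c) +
        w x (fun _ => b) * fderiv ℝ w x a (fun _ => c) -
        (fderiv ℝ w x a (fun _ => c) * w x (fun _ => b) +
        w x (fun _ => c) * fderiv ℝ w x a (fun _ => b))) := by
    intro a b c
    rw [← fderiv_alternating_apply hFd, ← fderiv_alternating_apply hed]
    have h1 : (fun y => flatCurvature w y ![b, c]) = fun y => extDeriv w y ![b, c] +
        (w y (fun _ => b) * w y (fun _ => c) - w y (fun _ => c) * w y (fun _ => b)) := by
      funext y
      rw [flatCurvature, ContinuousAlternatingMap.add_apply, half_bracketWedge_apply]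
      rfl
    have h2 : ∀ u, DifferentiableAt ℝ (fun y => w y (fun _ => u)) x := fun u =>
      (contDiffAt_oneForm_apply hw _).differentiableAt (by simp)
    have h3 : DifferentiableAt ℝ (fun y => extDeriv w y ![b, c]) x :=
      (contDiffAt_oneForm_apply (contDiffAt_extDeriv hw) _).differentiableAt (by simp)
    rw [h1]
    have h4 := (h3.hasFDerivAt.add (((h2 b).hasFDerivAt.mul' (h2 c).hasFDerivAt).sub
      ((h2 c).hasFDerivAt.mul' (h2 b).hasFDerivAt))).fderiv
    refine (congrArg (fun L : E →L[ℝ] Mat m => L a) h4).trans ?_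
    simp [fderiv_alternating_apply hwd]
    abel
  -- This is `d(dw) = 0` written out on three vectors.
  have hdd : fderiv ℝ (extDeriv w) x a ![b, c] + fderiv ℝ (extDeriv w) x b ![c, a] +
      fderiv ℝ (extDeriv w) x c ![a, b] = 0 := by
    have h1 : extDeriv (extDeriv w) x = 0 := extDeriv_extDeriv_apply hw (by simpa using ENat.LEInfty.out)
    have h2 : extDeriv (extDeriv w) x ![a, b, c] = 0 := by rw [h1]; rfl
    rw [extDeriv, ContinuousAlternatingMap.alternatizeUncurryFin_apply] at h2
    replace h2 := (Fin.sum_univ_three _).symm.trans h2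
    have e0 : (0 : Fin 3).removeNth ![a, b, c] = ![b, c] := by
      funext i; fin_cases i <;> rfl
    have e1 : (1 : Fin 3).removeNth ![a, b, c] = ![a, c] := by
      funext i; fin_cases i <;> rfl
    have e2 : (2 : Fin 3).removeNth ![a, b, c] = ![a, b] := by
      funext i; fin_cases i <;> rfl
    have e3 : fderiv ℝ (extDeriv w) x b ![a, c] = -fderiv ℝ (extDeriv w) x b ![c, a] := by
      have := (fderiv ℝ (extDeriv w) x b).toAlternatingMap.map_swap ![c, a]
        (show (0 : Fin 2) ≠ 1 by decide)
      have e4 : ![c, a] ∘ Equiv.swap (0 : Fin 2) 1 = ![a, c] := by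
        funext i; fin_cases i <;> simp
      rw [e4] at this
      exact this
    rw [e0, e1, e2] at h2
    simp [e3] at h2
    exact h2
  -- Apart from `hdd`, the products of `w` with its derivative cancel against the commutators with
  -- `dw`, and the cubic terms in `w` cancel by the Jacobi identity.
  simp only [covariantDeriv, hD, flatCurvature_apply]
  simp only [Matrix.cons_val_zero, Matrix.cons_val_one]
  rw [← sub_eq_zero, sub_zero] at hdd ⊢
  rw [← hdd]
  noncomm_ring

/-- By the Leibniz rule the derivative of `C(F, …, F)` is a sum of terms with one differentiated
slot. Infinitesimal invariance replaces that derivative by the covariant one. After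
antisymmetrization, cycling the three vectors in the differentiated slot produces the Bianchi sum in
each term. -/
theorem extDeriv_chernForm_eq_zero [FiniteDimensional ℝ E] {w : E → E [⋀^Fin 1]→L[ℝ] Mat m}
    {x : E} (hw : ContDiffAt ℝ ∞ w x) (k : ℕ) :
    extDeriv (fun y => wedgePower (chernPoly m k) (flatCurvature w y)) x = 0 := by
  have hF : ContDiffAt ℝ ∞ (flatCurvature w) x := contDiffAt_flatCurvature hw
  have hFd : DifferentiableAt ℝ (flatCurvature w) x := hF.differentiableAt (by simp)
  have hT : DifferentiableAt ℝ (fun y => wedgePower (chernPoly m k) (flatCurvature w y)) x :=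
    (contDiffAt_wedgePower _ hF).differentiableAt (by simp)
  have hD : ∀ (P : Fin k → Fin 2 → E) (a : E), DifferentiableAt ℝ
        (fun y => chernPoly m k (fun l => flatCurvature w y (P l))) x ∧
      fderiv ℝ (fun y => chernPoly m k (fun l => flatCurvature w y (P l))) x a =
        ∑ j, chernPoly m k (Function.update (fun l => flatCurvature w x (P l)) j
          (covariantDeriv w x a (P j))) := by
    intro P a
    have h1 : ∀ l, DifferentiableAt ℝ (fun y => flatCurvature w y (P l)) x := fun l =>
      (contDiffAt_oneForm_apply hF _).differentiableAt (by simp)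
    have h2 := ((chernPoly m k).hasFDerivAt (fun l => flatCurvature w x (P l))).comp x
      (hasFDerivAt_pi.2 fun l => (h1 l).hasFDerivAt)
    refine ⟨h2.differentiableAt, (congrArg (fun L : E →L[ℝ] ℂ => L a) h2.fderiv).trans ?_⟩
    simp only [ContinuousLinearMap.comp_apply, ContinuousMultilinearMap.linearDeriv_apply,
      ContinuousLinearMap.pi_apply, fderiv_alternating_apply hFd, covariantDeriv,
      ContinuousMultilinearMap.map_update_sub (chernPoly m k) _ _ (fderiv ℝ (flatCurvature w) x a _)
        (_ - _)]
    -- The commutators with `w x (fun _ => a)` over all slots add up to zero, so inserting them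
    -- costs nothing.
    rw [Finset.sum_sub_distrib,
      sum_chernPoly_commutator m k (fun l => flatCurvature w x (P l)) (w x fun _ => a), sub_zero]
  refine eq_zero_of_sum_sign_smul _ fun v => ?_
  let P (i : Fin (2 * k + 1)) (σ : Equiv.Perm (Fin (2 * k))) (l : Fin k)
      (v : Fin (2 * k + 1) → E) : Fin 2 → E :=
    ![v (i.succAbove (σ ⟨2 * l, by omega⟩)), v (i.succAbove (σ ⟨2 * l + 1, by omega⟩))]
  have hQ : ∀ v, extDeriv (fun y => wedgePower (chernPoly m k) (flatCurvature w y)) x v =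
      ∑ i : Fin (2 * k + 1), (-1) ^ i.val • ((2 : ℝ) ^ k)⁻¹ • ∑ σ : Equiv.Perm (Fin (2 * k)),
        Equiv.Perm.sign σ • ∑ j, chernPoly m k
          (Function.update (fun l => flatCurvature w x (P i σ l v)) j
            (covariantDeriv w x (v i) (P i σ j v))) := by
    intro v
    rw [extDeriv_apply hT]
    refine Finset.sum_congr rfl fun i _ => ?_
    congr 1
    simp only [wedgePower_apply]
    have h3 := (HasFDerivAt.fun_sum (u := Finset.univ) fun (σ : Equiv.Perm (Fin (2 * k))) _ =>
      ((hD (fun l => P i σ l v) (v i)).1.hasFDerivAt.const_smul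
        (Equiv.Perm.sign σ))).const_smul (((2 : ℝ) ^ k)⁻¹)
    refine (congrArg (fun L : E →L[ℝ] ℂ => L (v i)) h3.fderiv).trans ?_
    simp only [smul_apply, sum_apply]
    congr 1
    refine Finset.sum_congr rfl fun σ _ => ?_
    rw [(hD (fun l => P i σ l v) (v i)).2]
  -- The permutation sum moves inside, so that the direction `i`, the permutation `σ` and the
  -- differentiated slot `j` are fixed.
  simp only [hQ, Finset.smul_sum]
  rw [Finset.sum_comm]
  refine Finset.sum_eq_zero fun i _ => ?_
  rw [Finset.sum_comm]
  refine Finset.sum_eq_zero fun σ _ => ?_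
  rw [Finset.sum_comm]
  refine Finset.sum_eq_zero fun j _ => ?_
  set p := i.succAbove (σ ⟨2 * j, by omega⟩)
  set q := i.succAbove (σ ⟨2 * j + 1, by omega⟩)
  have hip : p ≠ i := Fin.succAbove_ne _ _
  have hiq : q ≠ i := Fin.succAbove_ne _ _
  have hpq : p ≠ q := by
    intro h
    have := σ.injective (Fin.succAbove_right_injective h)
    simp at this
  -- The even 3-cycle `i → p → q → i` on the positions feeding the covariant derivative; the other
  -- slots do not see it (`hPc`).
  let c : Equiv.Perm (Fin (2 * k + 1)) := Equiv.swap i p * Equiv.swap p q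
  have hci : c i = p := by
    simp [c, Equiv.swap_apply_of_ne_of_ne hip.symm hiq.symm]
  have hcp : c p = q := by
    simp [c, Equiv.swap_apply_of_ne_of_ne hiq hpq.symm]
  have hcq : c q = i := by simp [c]
  have hco : ∀ r, r ≠ i → r ≠ p → r ≠ q → c r = r := by
    intro r h1 h2 h3
    simp [c, Equiv.swap_apply_of_ne_of_ne h2 h3, Equiv.swap_apply_of_ne_of_ne h1 h2]
  refine sum_sign_smul_eq_zero_of_cyclic (W := ℂ) (fun u : Fin (2 * k + 1) → E =>
    (-1) ^ i.val • ((2 : ℝ) ^ k)⁻¹ • Equiv.Perm.sign σ • chernPoly m k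
      (Function.update (fun l => flatCurvature w x (P i σ l u)) j
        (covariantDeriv w x (u i) (P i σ j u)))) c ?_ (fun u => ?_) v
  · simp [c, Equiv.Perm.sign_swap hip.symm, Equiv.Perm.sign_swap hpq]
  have hPc : ∀ l, l ≠ j → ∀ u : Fin (2 * k + 1) → E, P i σ l (u ∘ c) = P i σ l u := by
    intro l hl u
    have hl' : (l : ℕ) ≠ j := fun h => hl (Fin.ext h)
    have h1 : ∀ (r s : Fin (2 * k)), (r : ℕ) ≠ s → i.succAbove (σ r) ≠ i.succAbove (σ s) :=
      fun r s hrs h => hrs (congrArg Fin.val (σ.injective (Fin.succAbove_right_injective h)))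
    simp only [P, Function.comp_apply]
    rw [hco _ (Fin.succAbove_ne _ _) (h1 _ _ (by simp; omega)) (h1 _ _ (by simp; omega)),
      hco _ (Fin.succAbove_ne _ _) (h1 _ _ (by simp; omega)) (h1 _ _ (by simp; omega))]
  have hup : ∀ (u : Fin (2 * k + 1) → E) (Z : Mat m),
      Function.update (fun l => flatCurvature w x (P i σ l (u ∘ c))) j Z =
        Function.update (fun l => flatCurvature w x (P i σ l u)) j Z := by
    intro u Z
    funext l
    by_cases hl : l = j
    · subst hl; simp
    · simp [hl, hPc l hl]
  rw [← smul_add, ← smul_add, ← smul_add, ← smul_add, ← smul_add, ← smul_add,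
    ← Function.comp_assoc, hup (u ∘ c), hup u, hup u, ← ContinuousMultilinearMap.map_update_add,
    ← ContinuousMultilinearMap.map_update_add]
  have hP : ∀ u : Fin (2 * k + 1) → E, P i σ j u = ![u p, u q] := fun u => rfl
  simp only [hP, Function.comp_apply, hci, hcp, hcq]
  rw [covariantDeriv_cyclic hw, (chernPoly m k).map_coord_zero j (Function.update_self ..)]
  simp

end Closed

/-! ### Pullbacks and exterior derivatives of forms on manifolds -/

section Manifold

variable {E M E' M' E'' M'' F : Type*} [NormedAddCommGroup E] [NormedSpace ℝ E]
  [TopologicalSpace M] [ChartedSpace E M]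
  [NormedAddCommGroup E'] [NormedSpace ℝ E'] [TopologicalSpace M'] [ChartedSpace E' M']
  [NormedAddCommGroup E''] [NormedSpace ℝ E''] [TopologicalSpace M''] [ChartedSpace E'' M'']
  [NormedAddCommGroup F] [NormedSpace ℝ F] {k : ℕ}

theorem pullback_comp_at {f : M → M'} {g : M' → M''} (α : DForm E'' M'' F k) {x : M}
    (hg : MDifferentiableAt 𝓘(ℝ, E') 𝓘(ℝ, E'') g (f x))
    (hf : MDifferentiableAt 𝓘(ℝ, E) 𝓘(ℝ, E') f x) :
    pullback (g ∘ f) α x = pullback (E := E) f (pullback (E := E') g α) x := by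
  ext v
  change α (g (f x)) (fun i => mfderiv 𝓘(ℝ, E) 𝓘(ℝ, E'') (g ∘ f) x (v i)) = _
  rw [mfderiv_comp x hg hf]
  rfl

theorem pullback_congr_at {f g : M → M'} (α : DForm E' M' F k) {x : M} (h : f =ᶠ[nhds x] g) :
    pullback (E := E) f α x = pullback g α x := by
  ext v
  change α (f x) _ = α (g x) _
  rw [h.self_of_nhds, h.mfderiv_eq]

theorem pullback_add (f : M → M') (α β : DForm E' M' F k) :
    pullback (E := E) f (α + β) = pullback f α + pullback f β := rfl

theorem pullback_smul (f : M → M') (c : ℝ) (α : DForm E' M' F k) :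
    pullback (E := E) f (c • α) = c • pullback f α := rfl

/-- Smoothness of a form at a point. -/
def SmoothFormAt (α : DForm E M F k) (x : M) : Prop :=
  ContDiffAt ℝ ∞ (localRep (chartAt E x) α) (chartAt E x x)

/-- The exterior derivative of a form at a point, computed in the preferred chart. -/
def extDForm (α : DForm E M F k) : DForm E M F (k + 1) := fun x =>
  (extDeriv (localRep (chartAt E x) α) (chartAt E x x)).compContinuousLinearMap
    (mfderiv 𝓘(ℝ, E) 𝓘(ℝ, E) (chartAt E x) x)

theorem extD_eq (α : smoothForms E M F k) : extD α = extDForm α.1 := rfl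

theorem pullback_id (α : DForm E M F k) : pullback id α = α := by
  funext x
  ext v
  change α x _ = α x v
  rw [mfderiv_id]
  rfl

theorem SmoothFormAt.congr {x : M} {α β : DForm E M F k} (hα : SmoothFormAt α x)
    (h : ∀ᶠ y in nhds x, β y = α y) : SmoothFormAt β x := by
  refine ContDiffAt.congr_of_eventuallyEq hα ?_
  have hc := (chartAt E x).continuousAt_symm (mem_chart_target E x)
  rw [ContinuousAt, (chartAt E x).left_inv (mem_chart_source E x)] at hc
  filter_upwards [hc.eventually h] with y hy
  rw [localRep, localRep, hy]

variable [IsManifold 𝓘(ℝ, E) ∞ M] [IsManifold 𝓘(ℝ, E') ∞ M'] [IsManifold 𝓘(ℝ, E'') ∞ M'']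

theorem eventually_mdifferentiableAt {f : M → M'} {x : M}
    (hf : ContMDiffAt 𝓘(ℝ, E) 𝓘(ℝ, E') ∞ f x) :
    ∀ᶠ y in nhds x, MDifferentiableAt 𝓘(ℝ, E) 𝓘(ℝ, E') f y := by
  -- Being `C^1` at a point spreads to a neighbourhood, whereas for order `∞` the neighbourhood may
  -- shrink with the order.
  have h1 : ContMDiffAt 𝓘(ℝ, E) 𝓘(ℝ, E') 1 f x := hf.of_le (by simp)
  filter_upwards [(contMDiffAt_iff_contMDiffAt_nhds (by simp)).1 h1] with y hy
  exact hy.mdifferentiableAt (by simp)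

/-- The expression in charts of a pullback. -/
theorem localRep_pullback {f : M → M'} {x : M} (hf : ContMDiffAt 𝓘(ℝ, E) 𝓘(ℝ, E') ∞ f x)
    (α : DForm E' M' F k) {e : OpenPartialHomeomorph M E} {e' : OpenPartialHomeomorph M' E'}
    (he : e ∈ atlas E M) (he' : e' ∈ atlas E' M') (hx : x ∈ e.source) (hx' : f x ∈ e'.source) :
    localRep e (pullback f α) =ᶠ[nhds (e x)] fun y =>
      (localRep e' α (e' (f (e.symm y)))).compContinuousLinearMap
        (fderiv ℝ (e' ∘ f ∘ e.symm) y) := by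
  have hc : ContinuousAt (f ∘ e.symm) (e x) := by
    refine ContinuousAt.comp ?_ (e.continuousAt_symm (e.map_source hx))
    rw [e.left_inv hx]
    exact hf.continuousAt
  have h1 : ∀ᶠ y in nhds (e x), y ∈ e.target ∧ f (e.symm y) ∈ e'.source ∧
      MDifferentiableAt 𝓘(ℝ, E) 𝓘(ℝ, E') f (e.symm y) := by
    refine Filter.Eventually.and (e.open_target.mem_nhds (e.map_source hx)) (.and ?_ ?_)
    · refine hc.eventually_mem (e'.open_source.mem_nhds ?_)
      simpa [e.left_inv hx] using hx'
    · have := (e.continuousAt_symm (e.map_source hx))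
      rw [ContinuousAt, e.left_inv hx] at this
      exact this.eventually (eventually_mdifferentiableAt hf)
  filter_upwards [h1.eventually_nhds] with y hy
  obtain ⟨hy1, hy2, hy3⟩ := hy.self_of_nhds
  have hes := mdifferentiableAt_atlas_symm (I := 𝓘(ℝ, E)) he hy1
  have he1 := mdifferentiableAt_atlas (I := 𝓘(ℝ, E')) he' hy2
  have he2 := mdifferentiableAt_atlas_symm (I := 𝓘(ℝ, E')) he' (e'.map_source hy2)
  -- Both sides are pullbacks of `α` along maps with the same germ, so functoriality suffices.
  have h2 : (e'.symm ∘ e' ∘ f ∘ e.symm) =ᶠ[nhds y] f ∘ e.symm := by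
    filter_upwards [hy] with z hz
    exact e'.left_inv hz.2.1
  rw [← mfderiv_eq_fderiv]
  change pullback e.symm (pullback f α) y = pullback (e' ∘ f ∘ e.symm) (pullback e'.symm α) y
  rw [← pullback_comp_at α hy3 hes, ← pullback_comp_at, pullback_congr_at α h2]
  · exact he2
  · exact he1.comp y (hy3.comp y hes)

theorem contDiffAt_chart_comp {f : M → M'} {x : M} (hf : ContMDiffAt 𝓘(ℝ, E) 𝓘(ℝ, E') ∞ f x)
    {e : OpenPartialHomeomorph M E} {e' : OpenPartialHomeomorph M' E'}
    (he : e ∈ atlas E M) (he' : e' ∈ atlas E' M') (hx : x ∈ e.source) (hx' : f x ∈ e'.source) :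
    ContDiffAt ℝ ∞ (e' ∘ f ∘ e.symm) (e x) := by
  rw [← contMDiffAt_iff_contDiffAt]
  have h1 : ContMDiffAt 𝓘(ℝ, E) 𝓘(ℝ, E) ∞ e.symm (e x) :=
    contMDiffAt_symm_of_mem_maximalAtlas (IsManifold.subset_maximalAtlas he) (e.map_source hx)
  have h2 : ContMDiffAt 𝓘(ℝ, E') 𝓘(ℝ, E') ∞ e' (f x) :=
    contMDiffAt_of_mem_maximalAtlas (IsManifold.subset_maximalAtlas he') hx'
  have h3 : ContMDiffAt 𝓘(ℝ, E) 𝓘(ℝ, E') ∞ (e' ∘ f) x := h2.comp x hf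
  rw [← e.left_inv hx] at h3
  exact h3.comp (e x) h1

theorem contDiffAt_localRep_pullback [FiniteDimensional ℝ E] [FiniteDimensional ℝ F]
    {f : M → M'} {x : M} (hf : ContMDiffAt 𝓘(ℝ, E) 𝓘(ℝ, E') ∞ f x)
    {α : DForm E' M' F k} (hα : SmoothFormAt α (f x)) {e : OpenPartialHomeomorph M E}
    (he : e ∈ atlas E M) (hx : x ∈ e.source) :
    ContDiffAt ℝ ∞ (localRep e (pullback f α)) (e x) := by
  refine ContDiffAt.congr_of_eventuallyEq ?_ (localRep_pullback hf α he (chart_mem_atlas E' (f x))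
    hx (mem_chart_source E' (f x)))
  have h1 := contDiffAt_chart_comp hf he (chart_mem_atlas E' (f x)) hx (mem_chart_source E' (f x))
  refine contDiffAt_alternating_compCLM ?_ (h1.fderiv_right (m := ∞) (by simp))
  refine ContDiffAt.comp (e x) (g := localRep (chartAt E' (f x)) α) ?_ h1
  rw [e.left_inv hx]
  exact hα

/-- A change of charts is the pullback along `id`, read in two different charts. -/
theorem SmoothFormAt.contDiffAt_localRep [FiniteDimensional ℝ E] [FiniteDimensional ℝ F]
    {x : M} {α : DForm E M F k} (hα : SmoothFormAt α x) {e : OpenPartialHomeomorph M E}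
    (he : e ∈ atlas E M) (hx : x ∈ e.source) : ContDiffAt ℝ ∞ (localRep e α) (e x) := by
  have := contDiffAt_localRep_pullback (f := id) (E := E) (M := M) contMDiffAt_id
    (α := α) hα he hx
  rwa [pullback_id] at this

theorem SmoothFormAt.pullback [FiniteDimensional ℝ E] [FiniteDimensional ℝ F]
    {f : M → M'} {x : M} {α : DForm E' M' F k} (hα : SmoothFormAt α (f x))
    (hf : ContMDiffAt 𝓘(ℝ, E) 𝓘(ℝ, E') ∞ f x) :
    SmoothFormAt (pullback (E := E) f α) x :=
  contDiffAt_localRep_pullback hf hα (chart_mem_atlas E x) (mem_chart_source E x)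

/-- The pointwise condition only tests each point in its own preferred chart; independence of the
chart carries it to every point of every chart target. -/
theorem mem_smoothForms_iff [FiniteDimensional ℝ E] [FiniteDimensional ℝ F] {α : DForm E M F k} :
    α ∈ smoothForms E M F k ↔ ∀ x, SmoothFormAt α x := by
  constructor
  · intro h x
    exact (h x).contDiffAt ((chartAt E x).open_target.mem_nhds (mem_chart_target E x))
  · intro h x y hy
    have := (h ((chartAt E x).symm y)).contDiffAt_localRep (chart_mem_atlas E x)
      ((chartAt E x).map_target hy)
    rw [(chartAt E x).right_inv hy] at this
    exact this.contDiffWithinAt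

/-- The exterior derivative commutes with pullbacks. -/
theorem extDForm_pullback {f : M → M'} {x : M} {α : DForm E' M' F k}
    (hα : SmoothFormAt α (f x)) (hf : ContMDiffAt 𝓘(ℝ, E) 𝓘(ℝ, E') ∞ f x) :
    extDForm (pullback (E := E) f α) x = pullback f (extDForm α) x := by
  have he := chart_mem_atlas E x
  have he' := chart_mem_atlas E' (f x)
  have hx := mem_chart_source E x
  have hx' := mem_chart_source E' (f x)
  have h1 := contDiffAt_chart_comp hf he he' hx hx'
  have h2 : extDeriv (localRep (chartAt E x) (pullback (E := E) f α)) (chartAt E x x) =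
      (extDeriv (localRep (chartAt E' (f x)) α) (chartAt E' (f x) (f x))).compContinuousLinearMap
        (fderiv ℝ (chartAt E' (f x) ∘ f ∘ (chartAt E x).symm) (chartAt E x x)) := by
    rw [(localRep_pullback hf α he he' hx hx').extDeriv_eq]
    have h3 : (chartAt E' (f x) ∘ f ∘ (chartAt E x).symm) (chartAt E x x) =
        chartAt E' (f x) (f x) := by simp
    have h4 : DifferentiableAt ℝ (localRep (chartAt E' (f x)) α)
        ((chartAt E' (f x) ∘ f ∘ (chartAt E x).symm) (chartAt E x x)) := by
      rw [h3]; exact ContDiffAt.differentiableAt hα (by simp)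
    rw [← h3]
    exact extDeriv_pullback h4 h1 (by simpa using ENat.LEInfty.out)
  have h5 : (chartAt E' (f x) ∘ f ∘ (chartAt E x).symm) ∘ chartAt E x =ᶠ[nhds x]
      chartAt E' (f x) ∘ f := by
    filter_upwards [(chartAt E x).open_source.mem_nhds hx] with y hy
    simp [(chartAt E x).left_inv hy]
  have h6 := mfderiv_comp x (contMDiffAt_iff_contDiffAt.2 h1 |>.mdifferentiableAt (by simp))
    (mdifferentiableAt_atlas (I := 𝓘(ℝ, E)) he hx)
  have h7 := mfderiv_comp x (mdifferentiableAt_atlas (I := 𝓘(ℝ, E')) he' hx')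
    (hf.mdifferentiableAt (by simp))
  ext v
  change extDeriv (localRep (chartAt E x) (RealChernWeil.pullback (E := E) f α)) (chartAt E x x) _ =
    extDeriv (localRep (chartAt E' (f x)) α) (chartAt E' (f x) (f x)) _
  rw [h2, ContinuousAlternatingMap.compContinuousLinearMap_apply]
  congr 1
  funext i
  have h8 := (h6.symm.trans h5.mfderiv_eq).trans h7
  rw [mfderiv_eq_fderiv] at h8
  exact congrArg (fun L : E →L[ℝ] E' => L (v i)) h8

/-- The exterior derivative may be computed in any chart. -/
theorem localRep_extDForm {e : OpenPartialHomeomorph M E} (he : e ∈ atlas E M) {x : M}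
    (hx : x ∈ e.source) {α : DForm E M F k} (hα : SmoothFormAt α x) :
    localRep e (extDForm α) (e x) = extDeriv (localRep e α) (e x) := by
  have h0 := chart_mem_atlas E x
  have hx0 := mem_chart_source E x
  have h1 := localRep_pullback (f := id) (E := E) (M := M) contMDiffAt_id α he h0 hx hx0
  have h2 := contDiffAt_chart_comp (f := id) (E := E) (M := M) contMDiffAt_id he h0 hx hx0
  rw [pullback_id] at h1
  rw [h1.extDeriv_eq]
  have h3 : (chartAt E x ∘ id ∘ e.symm) (e x) = chartAt E x x := by simp [hx]
  have h4 : DifferentiableAt ℝ (localRep (chartAt E x) α)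
      ((chartAt E x ∘ id ∘ e.symm) (e x)) := by
    rw [h3]; exact ContDiffAt.differentiableAt hα (by simp)
  refine Eq.trans ?_ (extDeriv_pullback h4 h2 (by simpa using ENat.LEInfty.out)).symm
  rw [h3]
  ext v
  have hm := mfderiv_comp (e x) (g := chartAt E x) (f := e.symm)
    (by rw [e.left_inv hx]; exact mdifferentiableAt_atlas (I := 𝓘(ℝ, E)) h0 hx0)
    (mdifferentiableAt_atlas_symm (I := 𝓘(ℝ, E)) he (e.map_source hx))
  rw [mfderiv_eq_fderiv] at hm
  -- The base point `e.symm (e x)` equals `x` only propositionally, and forms are dependent on the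
  -- point; generalizing it to `y` allows substitution.
  have key : ∀ y, y = x → ∀ u : Fin (k + 1) → E, (extDForm α y) u =
      extDeriv (localRep (chartAt E x) α) (chartAt E x x)
        (fun i => mfderiv 𝓘(ℝ, E) 𝓘(ℝ, E) (chartAt E x) y (u i)) := by
    rintro y rfl u
    rfl
  refine (key _ (e.left_inv hx) _).trans ?_
  rw [ContinuousAlternatingMap.compContinuousLinearMap_apply]
  congr 1
  funext i
  exact (congrArg (fun L : E →L[ℝ] E => L (v i)) hm).symm

theorem SmoothFormAt.extDForm [FiniteDimensional ℝ E] [FiniteDimensional ℝ F] {α : DForm E M F k}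
    (hα : ∀ x, SmoothFormAt α x) (x : M) : SmoothFormAt (extDForm α) x := by
  refine (contDiffAt_extDeriv (hα x)).congr_of_eventuallyEq ?_
  filter_upwards [(chartAt E x).open_target.mem_nhds (mem_chart_target E x)] with y hy
  have := localRep_extDForm (chart_mem_atlas E x) ((chartAt E x).map_target hy)
    (hα ((chartAt E x).symm y))
  rwa [(chartAt E x).right_inv hy] at this

end Manifold

/-! ### Forms and linear maps of the values, curvature of matrix-valued `1`-forms -/

section Values

variable {E M E' M' F F' : Type*} [NormedAddCommGroup E] [NormedSpace ℝ E]
  [TopologicalSpace M] [ChartedSpace E M]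
  [NormedAddCommGroup E'] [NormedSpace ℝ E'] [TopologicalSpace M'] [ChartedSpace E' M']
  [NormedAddCommGroup F] [NormedSpace ℝ F] [NormedAddCommGroup F'] [NormedSpace ℝ F'] {k m : ℕ}

/-- The form `L ∘ α` for a linear map `L` between the vector spaces of values. -/
def mapForm (L : F →L[ℝ] F') (α : DForm E M F k) : DForm E M F' k :=
  fun x => L.compContinuousAlternatingMap (α x)

theorem pullback_mapForm (L : F →L[ℝ] F') (α : DForm E' M' F k) (f : M → M') :
    pullback (E := E) f (mapForm L α) = mapForm L (pullback f α) := rfl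

theorem SmoothFormAt.mapForm {L : F →L[ℝ] F'} {α : DForm E M F k} {x : M}
    (h : SmoothFormAt α x) : SmoothFormAt (mapForm L α) x :=
  ContDiffAt.comp (g := ContinuousLinearMap.compContinuousAlternatingMapCLM ℝ E F F' (Fin k) L)
    _ (ContinuousLinearMap.contDiff _).contDiffAt h

theorem extDForm_mapForm {L : F →L[ℝ] F'} {α : DForm E M F k} {x : M} (h : SmoothFormAt α x) :
    extDForm (mapForm L α) x = mapForm L (extDForm α) x := by
  have h1 : DifferentiableAt ℝ (localRep (chartAt E x) α) (chartAt E x x) :=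
    ContDiffAt.differentiableAt h (by simp)
  have h2 := ((ContinuousLinearMap.compContinuousAlternatingMapCLM ℝ E F F' (Fin k) L).hasFDerivAt
    (x := localRep (chartAt E x) α (chartAt E x x))).comp (chartAt E x x) h1.hasFDerivAt
  ext v
  change extDeriv (localRep (chartAt E x) (mapForm L α)) (chartAt E x x) _ =
    L (extDeriv (localRep (chartAt E x) α) (chartAt E x x) _)
  rw [extDeriv, extDeriv, ContinuousAlternatingMap.alternatizeUncurryFin_apply,
    ContinuousAlternatingMap.alternatizeUncurryFin_apply, map_sum]
  refine Finset.sum_congr rfl fun i _ => ?_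
  rw [map_zsmul]
  congr 1
  exact congrArg (fun D : E →L[ℝ] E [⋀^Fin k]→L[ℝ] F' => D _ _) h2.fderiv

/-- This undoes `localRep`, so identities between chart expressions transfer back to the manifold.
-/
theorem pullback_mfderiv_chart [IsManifold 𝓘(ℝ, E) ∞ M] (β : DForm E M F k) (x : M)
    (v : Fin k → E) :
    β x v = localRep (chartAt E x) β (chartAt E x x)
      (fun i => mfderiv 𝓘(ℝ, E) 𝓘(ℝ, E) (chartAt E x) x (v i)) := by
  have he := chart_mem_atlas E x
  have hx := mem_chart_source E x
  have h1 := pullback_comp_at (E := E) (f := chartAt E x) (g := (chartAt E x).symm) β (x := x)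
    (mdifferentiableAt_atlas_symm he ((chartAt E x).map_source hx)) (mdifferentiableAt_atlas he hx)
  have h2 : (chartAt E x).symm ∘ chartAt E x =ᶠ[nhds x] id := by
    filter_upwards [(chartAt E x).open_source.mem_nhds hx] with y hy
    exact (chartAt E x).left_inv hy
  rw [pullback_congr_at β h2, pullback_id] at h1
  rw [h1]
  rfl

/-- The curvature `dα + ½ [α ∧ α]` of a matrix-valued `1`-form. -/
def curvatureForm (α : DForm E M (Mat m) 1) : DForm E M (Mat m) 2 :=
  fun x => extDForm α x + (1 / 2 : ℝ) • bracketWedge (α x) (α x)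

theorem curvatureForm_apply (α : DForm E M (Mat m) 1) (x : M) (v : Fin 2 → E) :
    curvatureForm α x v = extDForm α x v +
      (α x (fun _ => v 0) * α x (fun _ => v 1) - α x (fun _ => v 1) * α x (fun _ => v 0)) := by
  rw [curvatureForm]
  refine (ContinuousAlternatingMap.add_apply _ _ _).trans ?_
  exact congrArg (extDForm α x v + ·) (half_bracketWedge_apply (T := E) (α x) v)

/-- Multiplicativity of `L` handles the quadratic term. Entrywise conjugation qualifies; the adjoint
reverses products and needs its own argument in `conj_totalChernForm`. -/
theorem curvatureForm_mapForm {α : DForm E M (Mat m) 1} {x : M} {L : Mat m →L[ℝ] Mat m}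
    (hL : ∀ A B, L (A * B) = L A * L B) (h : SmoothFormAt α x) :
    curvatureForm (mapForm L α) x = mapForm L (curvatureForm α) x := by
  refine ContinuousAlternatingMap.ext fun (v : Fin 2 → E) => ?_
  refine (curvatureForm_apply (mapForm L α) x v).trans ?_
  refine Eq.trans ?_ (congrArg L (curvatureForm_apply α x v)).symm
  rw [extDForm_mapForm h, map_add, map_sub, hL, hL]
  rfl

/-- The form `C(F ∧ ⋯ ∧ F)` of a `2`-form `F`. -/
def wedgePowerForm {V : Type*} [NormedAddCommGroup V] [NormedSpace ℝ V]
    (C : ContinuousMultilinearMap ℝ (fun _ : Fin k => V) F) (β : DForm E M V 2) :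
    DForm E M F (2 * k) :=
  fun x => wedgePower C (β x)

theorem wedgePowerForm_apply {V : Type*} [NormedAddCommGroup V] [NormedSpace ℝ V]
    (C : ContinuousMultilinearMap ℝ (fun _ : Fin k => V) F) (β : DForm E M V 2) (x : M)
    (v : Fin (2 * k) → E) :
    wedgePowerForm C β x v = ((2 : ℝ) ^ k)⁻¹ • ∑ σ : Equiv.Perm (Fin (2 * k)),
      Equiv.Perm.sign σ •
        C (fun i => β x ![v (σ ⟨2 * i, by omega⟩), v (σ ⟨2 * i + 1, by omega⟩)]) :=
  wedgePower_apply C (β x) v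

theorem pullback_wedgePowerForm {V : Type*} [NormedAddCommGroup V] [NormedSpace ℝ V]
    (C : ContinuousMultilinearMap ℝ (fun _ : Fin k => V) F) (β : DForm E' M' V 2) (f : M → M') :
    pullback (E := E) f (wedgePowerForm C β) = wedgePowerForm C (pullback f β) := by
  funext x
  refine ContinuousAlternatingMap.ext fun (v : Fin (2 * k) → E) => ?_
  refine (wedgePowerForm_apply C β (f x) _).trans (Eq.trans ?_ (wedgePowerForm_apply C _ x v).symm)
  congr 1
  refine Finset.sum_congr rfl fun σ _ => ?_
  congr 2
  funext i
  change β (f x) _ = β (f x) _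
  congr 1
  funext j
  fin_cases j <;> rfl

theorem localRep_wedgePowerForm {V : Type*} [NormedAddCommGroup V] [NormedSpace ℝ V]
    (C : ContinuousMultilinearMap ℝ (fun _ : Fin k => V) F) (β : DForm E M V 2)
    (e : OpenPartialHomeomorph M E) (y : E) :
    localRep e (wedgePowerForm C β) y = wedgePower C (localRep e β y) :=
  congrFun (pullback_wedgePowerForm C β e.symm) y

variable [IsManifold 𝓘(ℝ, E) ∞ M] [IsManifold 𝓘(ℝ, E') ∞ M']

theorem curvatureForm_pullback {f : M → M'} {x : M} {α : DForm E' M' (Mat m) 1}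
    (hα : SmoothFormAt α (f x)) (hf : ContMDiffAt 𝓘(ℝ, E) 𝓘(ℝ, E') ∞ f x) :
    curvatureForm (pullback (E := E) f α) x = pullback f (curvatureForm α) x := by
  refine ContinuousAlternatingMap.ext fun (v : Fin 2 → E) => ?_
  refine (curvatureForm_apply (pullback f α) x v).trans ?_
  rw [extDForm_pullback hα hf]
  exact (curvatureForm_apply α (f x) _).symm

theorem localRep_curvatureForm {e : OpenPartialHomeomorph M E} (he : e ∈ atlas E M) {x : M}
    (hx : x ∈ e.source) {α : DForm E M (Mat m) 1} (hα : SmoothFormAt α x) :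
    localRep e (curvatureForm α) (e x) = flatCurvature (localRep e α) (e x) := by
  ext1 v
  rw [flatCurvature, ← localRep_extDForm he hx hα]
  refine Eq.trans ?_ (ContinuousAlternatingMap.add_apply _ _ _).symm
  rw [half_bracketWedge_apply]
  exact curvatureForm_apply α (e.symm (e x)) _

theorem localRep_curvatureForm_eventuallyEq {α : DForm E M (Mat m) 1}
    (hα : ∀ x, SmoothFormAt α x) (x : M) :
    localRep (chartAt E x) (curvatureForm α) =ᶠ[nhds (chartAt E x x)]
      flatCurvature (localRep (chartAt E x) α) := by
  filter_upwards [(chartAt E x).open_target.mem_nhds (mem_chart_target E x)] with y hy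
  have := localRep_curvatureForm (chart_mem_atlas E x) ((chartAt E x).map_target hy)
    (hα ((chartAt E x).symm y))
  rwa [(chartAt E x).right_inv hy] at this

theorem localRep_chernForm_eventuallyEq {α : DForm E M (Mat m) 1}
    (hα : ∀ x, SmoothFormAt α x) (x : M) :
    localRep (chartAt E x) (wedgePowerForm (chernPoly m k) (curvatureForm α))
      =ᶠ[nhds (chartAt E x x)]
        fun y => wedgePower (chernPoly m k) (flatCurvature (localRep (chartAt E x) α) y) := by
  filter_upwards [localRep_curvatureForm_eventuallyEq hα x] with y hy
  rw [localRep_wedgePowerForm, hy]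

theorem smoothFormAt_chernForm [FiniteDimensional ℝ E] {α : DForm E M (Mat m) 1}
    (hα : ∀ x, SmoothFormAt α x) (x : M) :
    SmoothFormAt (wedgePowerForm (chernPoly m k) (curvatureForm α)) x :=
  (contDiffAt_wedgePower _ (contDiffAt_flatCurvature (hα x))).congr_of_eventuallyEq
    (localRep_chernForm_eventuallyEq hα x)

theorem extDForm_chernForm [FiniteDimensional ℝ E] {α : DForm E M (Mat m) 1}
    (hα : ∀ x, SmoothFormAt α x) (x : M) :
    extDForm (wedgePowerForm (chernPoly m k) (curvatureForm α)) x = 0 := by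
  rw [extDForm, (localRep_chernForm_eventuallyEq hα x).extDeriv_eq,
    extDeriv_chernForm_eq_zero (hα x)]
  rfl

end Values

/-! ### The unitary group as a submanifold of the matrices -/

section Unitary

variable {m : ℕ}

theorem contDiff_cayley_uLie (u : Mat m) :
    ContDiff ℝ ∞ (fun A : uLie m => u * cayley (A : Mat m)) := by
  rw [contDiff_iff_contDiffAt]
  intro A
  exact contDiffAt_const.mul (ContDiffAt.comp A (contDiffAt_cayley (isUnit_one_add_of_mem A.2))
    (uLie m).subtypeL.contDiff.contDiffAt)

theorem contMDiff_coe_unitary :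
    ContMDiff 𝓘(ℝ, uLie m) 𝓘(ℝ, Mat m) ∞ (fun u : U m => (u : Mat m)) := by
  intro u
  have h1 : ContMDiffAt 𝓘(ℝ, uLie m) 𝓘(ℝ, uLie m) ∞ (chartAt (uLie m) u) u :=
    contMDiffAt_of_mem_maximalAtlas (IsManifold.chart_mem_maximalAtlas u)
      (mem_chart_source (uLie m) u)
  have h2 : ContMDiffAt 𝓘(ℝ, uLie m) 𝓘(ℝ, Mat m) ∞
      ((fun A : uLie m => (u : Mat m) * cayley (A : Mat m)) ∘ chartAt (uLie m) u) u :=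
    (contMDiffAt_iff_contDiffAt.2 (contDiff_cayley_uLie (u : Mat m)).contDiffAt).comp u h1
  refine h2.congr_of_eventuallyEq ?_
  filter_upwards [(chartAt (uLie m) u).open_source.mem_nhds (mem_chart_source (uLie m) u)] with v hv
  exact congrArg (fun w : U m => (w : Mat m)) ((chartAt (uLie m) u).left_inv hv).symm

theorem hasFDerivAt_exp_uLie (u : Mat m) :
    HasFDerivAt (fun ξ : uLie m => u * NormedSpace.exp (ξ : Mat m))
      ((ContinuousLinearMap.mul ℝ (Mat m) u).comp (uLie m).subtypeL) 0 := by
  have h1 : HasFDerivAt (NormedSpace.exp : Mat m → Mat m) (1 : Mat m →L[ℝ] Mat m)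
      ((uLie m).subtypeL 0) := by
    rw [map_zero]
    exact hasFDerivAt_exp_zero
  have h2 := h1.comp (0 : uLie m) (uLie m).subtypeL.hasFDerivAt
  exact ((ContinuousLinearMap.mul ℝ (Mat m) u).hasFDerivAt).comp (0 : uLie m) h2

theorem expU_zero : expU (0 : uLie m) = 1 := by
  apply Subtype.ext
  change NormedSpace.exp (0 : Mat m) = 1
  exact NormedSpace.exp_zero

/-- The manifold structure comes from Cayley charts, not from `exp`. In the chart at `u` the map
reads `ξ ↦ cayley (exp ξ)`, up to the projection `skewPart`. -/
theorem mdifferentiableAt_mul_expU (u : U m) :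
    MDifferentiableAt 𝓘(ℝ, uLie m) 𝓘(ℝ, uLie m) (fun ξ : uLie m => u * expU ξ) 0 := by
  have hc : ContinuousAt (fun ξ : uLie m => u * expU ξ) 0 := by
    exact Topology.IsInducing.subtypeVal.continuousAt_iff.2 (hasFDerivAt_exp_uLie (u : Mat m)).continuousAt
  have h0 : u * expU (0 : uLie m) = u := by rw [expU_zero, mul_one]
  have h1 : DifferentiableAt ℝ (fun ξ : uLie m =>
      skewPart m (cayley (1 * NormedSpace.exp (ξ : Mat m)))) 0 := by
    refine (skewPart m).differentiableAt.comp (0 : uLie m) ?_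
    refine DifferentiableAt.comp (0 : uLie m) (g := cayley (m := m)) ?_
      (hasFDerivAt_exp_uLie (1 : Mat m)).differentiableAt
    refine (contDiffAt_cayley ?_).differentiableAt (by simp)
    have h2 := mem_chart_source (uLie m) (1 : U m)
    change IsUnit (1 + (((1 : U m)⁻¹ * 1 : U m) : Mat m)) at h2
    simpa using h2
  have h2 : MDifferentiableAt 𝓘(ℝ, uLie m) 𝓘(ℝ, uLie m) (chartAt (uLie m) u).symm
      (skewPart m (cayley (1 * NormedSpace.exp (((0 : uLie m) : uLie m) : Mat m)))) :=
    mdifferentiableAt_atlas_symm (chart_mem_atlas _ u) (Set.mem_univ _)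
  have h3 := h2.comp (0 : uLie m) h1.mdifferentiableAt
  refine h3.congr_of_eventuallyEq ?_
  have h4 : ∀ᶠ ξ in nhds (0 : uLie m), u * expU ξ ∈ (chartAt (uLie m) u).source := by
    refine hc.eventually_mem ((chartAt (uLie m) u).open_source.mem_nhds ?_)
    rw [h0]
    exact mem_chart_source (uLie m) u
  filter_upwards [h4] with ξ hξ
  rw [← (chartAt (uLie m) u).left_inv hξ]
  change (chartAt (uLie m) u).symm (skewPart m (cayley ((u⁻¹ * (u * expU ξ) : U m) : Mat m))) = _
  rw [inv_mul_cancel_left, Function.comp_apply, one_mul]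
  rfl

/-- Every tangent vector of `U(m)` at `u` is the velocity of a curve `t ↦ u e^{tξ}`. -/
theorem exists_velocity_eq (u : U m) (ζ : TangentSpace 𝓘(ℝ, uLie m) u) :
    ∃ ξ : uLie m,
      MDifferentiableAt 𝓘(ℝ, ℝ) 𝓘(ℝ, uLie m) (fun t : ℝ => u * expU (t • ξ)) 0 ∧
      (mfderiv 𝓘(ℝ, ℝ) 𝓘(ℝ, uLie m) (fun t : ℝ => u * expU (t • ξ)) 0 : ℝ →L[ℝ] uLie m) 1 = ζ ∧
      mfderiv 𝓘(ℝ, uLie m) 𝓘(ℝ, Mat m) (fun w : U m => (w : Mat m)) u ζ =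
        (u : Mat m) * (ξ : Mat m) := by
  have h0 : u * expU (0 : uLie m) = u := by rw [expU_zero, mul_one]
  let L : uLie m →L[ℝ] uLie m :=
    mfderiv 𝓘(ℝ, uLie m) 𝓘(ℝ, uLie m) (fun ξ : uLie m => u * expU ξ) 0
  let J : uLie m →L[ℝ] Mat m :=
    mfderiv 𝓘(ℝ, uLie m) 𝓘(ℝ, Mat m) (fun w : U m => (w : Mat m)) u
  have hJL : ∀ ξ : uLie m, J (L ξ) = (u : Mat m) * (ξ : Mat m) := by
    intro ξ
    have h1 := mfderiv_comp_of_eq (x := (0 : uLie m)) (y := u)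
      ((contMDiff_coe_unitary (m := m)).mdifferentiableAt (by simp))
      (mdifferentiableAt_mul_expU u) h0
    have h2 := (hasFDerivAt_exp_uLie (u : Mat m)).fderiv
    rw [← mfderiv_eq_fderiv] at h2
    have h3 : ∀ y : U m, y = u → ∀ ζ : uLie m,
        (mfderiv 𝓘(ℝ, uLie m) 𝓘(ℝ, Mat m) (fun w : U m => (w : Mat m)) y : uLie m →L[ℝ] Mat m) ζ =
          J ζ := by
      rintro y rfl ζ
      rfl
    rw [← h3 _ h0]
    exact congrArg (fun K : uLie m →L[ℝ] Mat m => K ξ) (h1.symm.trans h2)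
  -- `J ∘ L` is left multiplication by the invertible `u`. An injective endomorphism of the
  -- finite-dimensional `𝔲(m)` is onto, which provides `ξ`.
  have hinj : Function.Injective (L : uLie m →ₗ[ℝ] uLie m) := by
    intro ξ ξ' h
    have h1 : L ξ = L ξ' := h
    have h2 : (u : Mat m) * (ξ : Mat m) = (u : Mat m) * (ξ' : Mat m) := by
      rw [← hJL, ← hJL, h1]
    have h3 : star (u : Mat m) * (u : Mat m) = 1 := Matrix.mem_unitaryGroup_iff'.1 u.2
    apply Subtype.ext
    have h4 := congrArg (fun Z => star (u : Mat m) * Z) h2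
    simpa [← mul_assoc, h3] using h4
  obtain ⟨ξ, hξ⟩ := (LinearMap.injective_iff_surjective.1 hinj) ζ
  have hs : HasFDerivAt (fun t : ℝ => t • ξ) (ContinuousLinearMap.toSpanSingleton ℝ ξ) 0 :=
    (ContinuousLinearMap.toSpanSingleton ℝ ξ).hasFDerivAt
  have h1 : MDifferentiableAt 𝓘(ℝ, uLie m) 𝓘(ℝ, uLie m) (fun ξ : uLie m => u * expU ξ)
      ((0 : ℝ) • ξ) := by
    rw [zero_smul]; exact mdifferentiableAt_mul_expU u
  refine ⟨ξ, MDifferentiableAt.comp (g := fun ξ : uLie m => u * expU ξ) (0 : ℝ) h1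
    hs.differentiableAt.mdifferentiableAt, ?_, ?_⟩
  · have h2 := mfderiv_comp_of_eq (x := (0 : ℝ)) (y := (0 : uLie m)) (f := fun t : ℝ => t • ξ)
      (mdifferentiableAt_mul_expU u) hs.differentiableAt.mdifferentiableAt (zero_smul ℝ ξ)
    rw [mfderiv_eq_fderiv, hs.fderiv] at h2
    refine (congrArg (fun K : ℝ →L[ℝ] uLie m => K 1) h2).trans ?_
    have h3 : ∀ y : uLie m, y = 0 → ∀ ζ : uLie m,
        (mfderiv 𝓘(ℝ, uLie m) 𝓘(ℝ, uLie m) (fun ξ : uLie m => u * expU ξ) y :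
          uLie m →L[ℝ] uLie m) ζ = L ζ := by
      rintro y rfl ζ
      rfl
    refine (h3 _ (zero_smul ℝ ξ) ((1 : ℝ) • ξ)).trans ?_
    rw [one_smul]
    exact hξ
  · rw [← hJL ξ]
    exact congrArg J hξ.symm

end Unitary

/-- The derivative of a map between manifolds, as a linear map between the model spaces. -/
def modelDeriv {E M E' M' : Type*} [NormedAddCommGroup E] [NormedSpace ℝ E] [TopologicalSpace M]
    [ChartedSpace E M] [NormedAddCommGroup E'] [NormedSpace ℝ E'] [TopologicalSpace M']
    [ChartedSpace E' M'] (f : M → M') (x : M) : E →L[ℝ] E' :=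
  mfderiv 𝓘(ℝ, E) 𝓘(ℝ, E') f x

/-! ### Local sections, and connection and curvature in a local gauge -/

namespace PrincipalUBundle

variable {m : ℕ} {E X EP P : Type*} [NormedAddCommGroup E] [NormedSpace ℝ E]
  [TopologicalSpace X] [ChartedSpace E X] [NormedAddCommGroup EP] [NormedSpace ℝ EP]
  [TopologicalSpace P] [ChartedSpace EP P] (B : PrincipalUBundle m E X EP P)

theorem proj_act (p : P) (u : U m) : B.proj (B.act p u) = B.proj p := by
  obtain ⟨q, hq⟩ := B.fibre_orbit (B.proj p)
  have h1 : p ∈ B.proj ⁻¹' {B.proj p} := rfl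
  rw [hq] at h1
  obtain ⟨v, hv⟩ := h1
  have h2 : B.act p u ∈ Set.range (B.act q) := ⟨v * u, by rw [B.act_mul, hv]⟩
  rw [← hq] at h2
  exact h2

/-- Local sections exist, and every point over their domain is a translate of the section by a
unitary matrix depending smoothly on the point. -/
theorem exists_section (x₀ : X) : ∃ V : Set X, IsOpen V ∧ x₀ ∈ V ∧ ∃ (s : X → P) (h : P → U m),
    ContMDiffOn 𝓘(ℝ, E) 𝓘(ℝ, EP) ∞ s V ∧
    ContMDiffOn 𝓘(ℝ, EP) 𝓘(ℝ, uLie m) ∞ h (B.proj ⁻¹' V) ∧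
    (∀ x ∈ V, B.proj (s x) = x) ∧
    ∀ p, B.proj p ∈ V → B.act (s (B.proj p)) (h p) = p := by
  obtain ⟨V, hV, hx, h, s, hh, hs, hsp, hps, hact⟩ := B.locally_trivial x₀
  refine ⟨V, hV, hx, fun x => s (x, 1), h, ?_, hh, fun x hx => (hps x hx 1).1, fun p hp => ?_⟩
  · exact hs.comp (t := V ×ˢ Set.univ) (f := fun x : X => (x, (1 : U m)))
      (contMDiffOn_id.prodMk contMDiffOn_const) fun x hx => ⟨hx, Set.mem_univ _⟩
  · have h1 := hps (B.proj p) hp 1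
    have h2 : B.proj (B.act (s (B.proj p, 1)) (h p)) = B.proj p := by rw [proj_act, h1.1]
    -- The translate of the section and `p` have the same coordinates in the trivialization, hence
    -- coincide.
    have h3 := hsp (B.act (s (B.proj p, 1)) (h p)) (by rw [h2]; exact hp)
    rw [h2, hact _ (by rw [h1.1]; exact hp), h1.2, one_mul, hsp p hp] at h3
    exact h3.symm

variable {B}
namespace Connection

theorem curvature_eq (A : B.Connection) : A.curvature = curvatureForm A.form.1 := rfl

theorem totalChernForm_eq (A : B.Connection) (k : ℕ) :
    A.totalChernForm k = wedgePowerForm (chernPoly m k) (curvatureForm A.form.1) := rfl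

/-- Along an orbit a connection form is the Maurer–Cartan form `u⁻¹ du`: write `ζ` as the velocity
of `t ↦ u e^{tξ}`. The orbit map sends it to the fundamental vector of `ξ` at `q u`, where the form
takes the value `ξ`. -/
theorem form_fundamental_component (A : B.Connection) {q : P} {u : U m} (ζ : uLie m) :
    A.form.1 (B.act q u) (fun _ => modelDeriv (E := uLie m) (E' := EP) (B.act q) u ζ) =
      ((u⁻¹ : U m) : Mat m) *
        modelDeriv (E := uLie m) (E' := Mat m) (fun w : U m => (w : Mat m)) u ζ := by
  obtain ⟨ξ, hd, h1, h2⟩ := exists_velocity_eq u ζ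
  have h3 : ((u⁻¹ : U m) : Mat m) * ((u : Mat m) * (ξ : Mat m)) = ξ := by
    rw [← mul_assoc]
    have : ((u⁻¹ * u : U m) : Mat m) = 1 := by rw [inv_mul_cancel]; rfl
    rw [show ((u⁻¹ : U m) : Mat m) * (u : Mat m) = 1 from this, one_mul]
  have h4 : u * expU ((0 : ℝ) • ξ) = u := by rw [zero_smul, expU_zero, mul_one]
  have hact : ContMDiff 𝓘(ℝ, uLie m) 𝓘(ℝ, EP) ∞ (B.act q) :=
    B.contMDiff_act.comp (contMDiff_const.prodMk contMDiff_id)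
  have h5 := mfderiv_comp_of_eq (x := (0 : ℝ)) (y := u) (f := fun t : ℝ => u * expU (t • ξ))
    (hact.mdifferentiableAt (by simp)) hd h4
  have h6 : B.act q ∘ (fun t : ℝ => u * expU (t • ξ)) =
      fun t : ℝ => B.act (B.act q u) (expU (t • ξ)) := by
    funext t
    exact B.act_mul q u _
  rw [h6] at h5
  have h7 : modelDeriv (E := uLie m) (E' := EP) (B.act q) u ζ =
      B.fundamental ξ (B.act q u) := by
    have h8 : ∀ y : U m, y = u → ∀ ζ : uLie m,
        modelDeriv (E := uLie m) (E' := EP) (B.act q) y ζ =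
        modelDeriv (E := uLie m) (E' := EP) (B.act q) u ζ := by
      rintro y rfl ζ
      rfl
    refine (h8 _ h4 ζ).symm.trans (Eq.trans (congrArg (modelDeriv (E := uLie m) (E' := EP)
      (B.act q) (u * expU ((0 : ℝ) • ξ))) h1.symm) ?_)
    exact (congrArg (fun K : ℝ →L[ℝ] EP => K 1) h5).symm
  rw [h7]
  refine (A.vertical (B.act q u) ξ).trans ?_
  rw [← h3]
  exact congrArg (((u⁻¹ : U m) : Mat m) * ·) h2.symm

/-- The expression of a connection form through a local gauge. -/
theorem form_eq_gauge (A : B.Connection) {σ : P → P} {h : P → U m} {p : P}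
    (hσ : MDifferentiableAt 𝓘(ℝ, EP) 𝓘(ℝ, EP) σ p)
    (hh : MDifferentiableAt 𝓘(ℝ, EP) 𝓘(ℝ, uLie m) h p)
    (hact : ∀ᶠ q in nhds p, B.act (σ q) (h q) = q) (v : EP) :
    A.form.1 p (fun _ => v) =
      (((h p)⁻¹ : U m) : Mat m) * pullback (E := EP) σ A.form.1 p (fun _ => v) * (h p : Mat m) +
      (((h p)⁻¹ : U m) : Mat m) *
        modelDeriv (E := EP) (E' := Mat m) (fun q => (h q : Mat m)) p v := by
  have hp : B.act (σ p) (h p) = p := hact.self_of_nhds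
  have ha := B.contMDiff_act.mdifferentiableAt (x := (σ p, h p)) (by simp)
  have h1 := mfderiv_comp p (g := fun q : P × U m => B.act q.1 q.2) (f := fun q => (σ q, h q)) ha
    (hσ.prodMk hh)
  have h2 : (fun q : P × U m => B.act q.1 q.2) ∘ (fun q => (σ q, h q)) =ᶠ[nhds p] id := hact
  rw [h2.mfderiv_eq, mfderiv_id, mfderiv_prodMk hσ hh] at h1
  have h3 := congrArg (fun K : EP →L[ℝ] EP => K v) h1
  have h4 := fun v : TangentSpace (𝓘(ℝ, EP).prod 𝓘(ℝ, uLie m)) (σ p, h p) =>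
    mfderiv_prod_eq_add_apply (v := v) ha
  -- Differentiating `σ(q) h(q) = q` splits `v` into a part moved by the fixed matrix `h p`,
  -- governed by equivariance, and a part tangent to the orbit.
  have h5 : v = modelDeriv (E := EP) (E' := EP) (fun q => B.act q (h p)) (σ p)
        (modelDeriv (E := EP) (E' := EP) σ p v) +
      modelDeriv (E := uLie m) (E' := EP) (B.act (σ p)) (h p)
        (modelDeriv (E := EP) (E' := uLie m) h p v) :=
    h3.trans (h4 (modelDeriv (E := EP) (E' := EP) σ p v,
      modelDeriv (E := EP) (E' := uLie m) h p v))
  have hadd : ∀ (r : P) (a b : EP), A.form.1 r (fun _ => a + b) =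
      A.form.1 r (fun _ => a) + A.form.1 r (fun _ => b) := fun r a b =>
    ((ContinuousAlternatingMap.ofSubsingleton ℝ EP (Mat m) (0 : Fin 1)).symm
      (A.form.1 r)).map_add a b
  have h6 : ∀ r, r = p → A.form.1 p (fun _ => v) = A.form.1 r (fun _ => v) := by
    rintro r rfl; rfl
  rw [h6 _ hp]
  refine (congrArg (fun z : EP => A.form.1 (B.act (σ p) (h p)) (fun _ => z)) h5).trans ?_
  refine (hadd _ _ _).trans ?_
  congr 1
  · exact A.equivariant (h p) (σ p) _
  · refine (A.form_fundamental_component _).trans ?_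
    congr 1
    have h7 := mfderiv_comp p (g := fun w : U m => (w : Mat m)) (f := h)
      ((contMDiff_coe_unitary (m := m)).mdifferentiableAt (by simp)) hh
    exact (congrArg (fun K : EP →L[ℝ] Mat m => K v) h7).symm

variable [IsManifold 𝓘(ℝ, EP) ∞ P] [FiniteDimensional ℝ EP]

theorem smoothFormAt (A : B.Connection) (p : P) : SmoothFormAt A.form.1 p :=
  mem_smoothForms_iff.1 A.form.2 p

/-- The curvature expressed through a local gauge. -/
theorem curvature_eq_gauge (A : B.Connection) {σ : P → P} {h : P → U m} {p : P}
    (hσ : ContMDiffAt 𝓘(ℝ, EP) 𝓘(ℝ, EP) ∞ σ p)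
    (hh : ContMDiffAt 𝓘(ℝ, EP) 𝓘(ℝ, uLie m) ∞ h p)
    (hact : ∀ᶠ q in nhds p, B.act (σ q) (h q) = q) (v : Fin 2 → EP) :
    A.curvature p v = (((h p)⁻¹ : U m) : Mat m) *
      pullback (E := EP) σ A.curvature p v * (h p : Mat m) := by
  have he := chart_mem_atlas EP p
  have hx := mem_chart_source EP p
  set e := chartAt EP p
  have hpe : e.symm (e p) = p := e.left_inv hx
  have hW : SmoothFormAt (pullback (E := EP) σ A.form.1) p := (A.smoothFormAt (σ p)).pullback hσ
  have hc : ContMDiffAt 𝓘(ℝ, EP) 𝓘(ℝ, Mat m) ∞ (fun q => (h q : Mat m)) p :=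
    (contMDiff_coe_unitary (m := m)).contMDiffAt.comp p hh
  have hes : ContMDiffAt 𝓘(ℝ, EP) 𝓘(ℝ, EP) ∞ e.symm (e p) :=
    contMDiffAt_symm_of_mem_maximalAtlas (IsManifold.subset_maximalAtlas he) (e.map_source hx)
  have hg : ContDiffAt ℝ ∞ (fun y => (h (e.symm y) : Mat m)) (e p) := by
    rw [← contMDiffAt_iff_contDiffAt]
    rw [← hpe] at hc
    exact hc.comp (e p) hes
  have hcoe : ∀ u : U m, ((u⁻¹ : U m) : Mat m) = star (u : Mat m) := fun u => rfl
  have hinv : ∀ u : U m, ((u⁻¹ : U m) : Mat m) * (u : Mat m) = 1 := fun u => by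
    rw [hcoe]
    exact Matrix.mem_unitaryGroup_iff'.1 u.2
  have hh' : DifferentiableAt ℝ (fun y => (((h (e.symm y))⁻¹ : U m) : Mat m)) (e p) := by
    simp only [hcoe]
    exact (hg.differentiableAt (by simp)).star
  have hev : ∀ᶠ y in nhds (e p), y ∈ e.target ∧
      MDifferentiableAt 𝓘(ℝ, EP) 𝓘(ℝ, EP) σ (e.symm y) ∧
      MDifferentiableAt 𝓘(ℝ, EP) 𝓘(ℝ, uLie m) h (e.symm y) ∧
      ∀ᶠ q in nhds (e.symm y), B.act (σ q) (h q) = q := by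
    have h1 := e.continuousAt_symm (e.map_source hx)
    rw [ContinuousAt, hpe] at h1
    exact Filter.Eventually.and (e.open_target.mem_nhds (e.map_source hx))
      (h1.eventually ((eventually_mdifferentiableAt hσ).and
        ((eventually_mdifferentiableAt hh).and hact.eventually_nhds)))
  -- In the chart `e`, the form and its pullback along `σ` are gauge transforms of each other by `h
  -- ∘ e.symm`.
  have key := flatCurvature_gauge (w := localRep e A.form.1)
    (W := localRep e (pullback (E := EP) σ A.form.1)) (x := e p)
    (g := fun y => (h (e.symm y) : Mat m)) (h := fun y => (((h (e.symm y))⁻¹ : U m) : Mat m))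
    (ContDiffAt.differentiableAt (A.smoothFormAt p) (by simp))
    (ContDiffAt.differentiableAt hW (by simp))
    (hg.of_le (by simpa using ENat.LEInfty.out)) hh'
    (Filter.Eventually.of_forall fun y => hinv _) (by
      filter_upwards [hev] with y hy v
      obtain ⟨hy1, hy2, hy3, hy4⟩ := hy
      have hd := mdifferentiableAt_atlas_symm (I := 𝓘(ℝ, EP)) he hy1
      refine (A.form_eq_gauge hy2 hy3 hy4
        ((mfderiv 𝓘(ℝ, EP) 𝓘(ℝ, EP) e.symm y : EP →L[ℝ] EP) v)).trans ?_
      congr 2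
      have h1 := mfderiv_comp y (g := fun q => (h q : Mat m)) (f := e.symm)
        (((contMDiff_coe_unitary (m := m)).mdifferentiableAt (by simp)).comp (e.symm y) hy3) hd
      rw [mfderiv_eq_fderiv] at h1
      exact (congrArg (fun K : EP →L[ℝ] Mat m => K v) h1).symm)
    (fun i => (mfderiv 𝓘(ℝ, EP) 𝓘(ℝ, EP) e p : EP →L[ℝ] EP) (v i))
  rw [← localRep_curvatureForm he hx (A.smoothFormAt p), ← localRep_curvatureForm he hx hW] at key
  have h1 := pullback_mfderiv_chart (curvatureForm A.form.1) p v
  have h2 := pullback_mfderiv_chart (curvatureForm (pullback (E := EP) σ A.form.1)) p v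
  rw [curvatureForm_pullback (A.smoothFormAt (σ p)) hσ] at h2
  rw [curvature_eq]
  refine h1.trans (key.trans ?_)
  simp only [hpe]
  congr 2
  exact h2.symm

/-- The curvature only gets conjugated by `h p`, which `C_k` does not notice. -/
theorem totalChernForm_eq_gauge (A : B.Connection) (k : ℕ) {σ : P → P} {h : P → U m} {p : P}
    (hσ : ContMDiffAt 𝓘(ℝ, EP) 𝓘(ℝ, EP) ∞ σ p)
    (hh : ContMDiffAt 𝓘(ℝ, EP) 𝓘(ℝ, uLie m) ∞ h p)
    (hact : ∀ᶠ q in nhds p, B.act (σ q) (h q) = q) :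
    A.totalChernForm k p = pullback (E := EP) σ (A.totalChernForm k) p := by
  rw [totalChernForm_eq, pullback_wedgePowerForm]
  refine ContinuousAlternatingMap.ext fun (v : Fin (2 * k) → EP) => ?_
  refine (wedgePowerForm_apply _ _ p v).trans
    (Eq.trans ?_ (wedgePowerForm_apply _ _ p v).symm)
  congr 1
  refine Finset.sum_congr rfl fun ρ _ => ?_
  congr 1
  have h1 : ((h p : U m) : Mat m) * (((h p)⁻¹ : U m) : Mat m) = 1 :=
    Matrix.mem_unitaryGroup_iff.1 (h p).2
  refine Eq.trans ?_ (chernPoly_conj_invariant m k _ h1)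
  congr 1
  funext i
  exact A.curvature_eq_gauge hσ hh hact _

/-- The form `C_k(F ∧ ⋯ ∧ F)` is the pullback of its restriction to a local section. -/
theorem totalChernForm_eq_pullback_section (A : B.Connection) (k : ℕ) {V : Set X} (hV : IsOpen V)
    {s : X → P} {h : P → U m} (hs : ContMDiffOn 𝓘(ℝ, E) 𝓘(ℝ, EP) ∞ s V)
    (hh : ContMDiffOn 𝓘(ℝ, EP) 𝓘(ℝ, uLie m) ∞ h (B.proj ⁻¹' V))
    (hact : ∀ p, B.proj p ∈ V → B.act (s (B.proj p)) (h p) = p) {p : P} (hp : B.proj p ∈ V) :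
    A.totalChernForm k p =
      pullback (E := EP) B.proj (pullback (E := E) s (A.totalChernForm k)) p := by
  have hV' : IsOpen (B.proj ⁻¹' V) := hV.preimage B.contMDiff_proj.continuous
  have hs' : ContMDiffAt 𝓘(ℝ, E) 𝓘(ℝ, EP) ∞ s (B.proj p) := hs.contMDiffAt (hV.mem_nhds hp)
  rw [← pullback_comp_at _ (hs'.mdifferentiableAt (by simp))
    (B.contMDiff_proj.mdifferentiableAt (by simp))]
  refine A.totalChernForm_eq_gauge k (hs'.comp p B.contMDiff_proj.contMDiffAt)
    (hh.contMDiffAt (hV'.mem_nhds hp)) ?_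
  filter_upwards [hV'.mem_nhds hp] with q hq using hact q hq

/-- The curvature stays in `𝔲(m)`: `d` commutes with the real-linear map `star`, and commutators of
anti-Hermitian matrices are anti-Hermitian. On such arguments `C_k` is real. -/
theorem conj_totalChernForm (A : B.Connection) (k : ℕ) (p : P) (v : Fin (2 * k) → EP) :
    starRingEnd ℂ (A.totalChernForm k p v) = A.totalChernForm k p v := by
  let S : Mat m →L[ℝ] Mat m := LinearMap.toContinuousLinearMap
    { toFun := fun A => star A
      map_add' := fun A B => star_add A B
      map_smul' := fun c A => by simp [star_smul] }
  have hS : mapForm S A.form.1 = (-1 : ℝ) • A.form.1 := by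
    funext q
    refine ContinuousAlternatingMap.ext fun (v : Fin 1 → EP) => ?_
    have h1 : star (A.form.1 q v) = -A.form.1 q v := A.mem_uLie q v
    exact h1.trans (neg_one_smul ℝ (A.form.1 q v)).symm
  have hd : ∀ u : Fin 2 → EP, star (extDForm A.form.1 p u) = -extDForm A.form.1 p u := by
    intro u
    have h1 := extDForm_mapForm (L := S) (A.smoothFormAt p)
    have h2 : extDForm ((-1 : ℝ) • A.form.1) = (-1 : ℝ) • extDForm A.form.1 :=
      extD.map_smul (-1 : ℝ) A.form
    rw [hS, h2] at h1
    have h3 := congrArg (fun α : EP [⋀^Fin 2]→L[ℝ] Mat m => α u) h1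
    exact h3.symm.trans (neg_one_smul ℝ (extDForm A.form.1 p u))
  have hF : ∀ u : Fin 2 → EP, curvatureForm A.form.1 p u ∈ uLie m := by
    intro u
    have h0 : ∀ v : Fin 1 → EP, star (A.form.1 p v) = -A.form.1 p v := A.mem_uLie p
    rw [RealChernWeil.mem_uLie, curvatureForm_apply, star_add, hd, star_sub, star_mul, star_mul, h0, h0]
    noncomm_ring
  have h1 : A.totalChernForm k p v = _ :=
    wedgePowerForm_apply (chernPoly m k) (curvatureForm A.form.1) p v
  rw [h1, Complex.real_smul, map_mul, map_sum, Complex.conj_ofReal]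
  congr 1
  refine Finset.sum_congr rfl fun σ _ => ?_
  rw [Units.smul_def, map_zsmul]
  exact congrArg (fun z : ℂ => ((Equiv.Perm.sign σ : ℤˣ) : ℤ) • z)
    (conj_chernPoly_of_mem m k _ fun i => hF _)

end Connection

end PrincipalUBundle

/-! ### Descent to the base: existence, uniqueness, closedness and parity of the Chern form -/

namespace PrincipalUBundle

variable {m : ℕ} {E X EP P : Type*} [NormedAddCommGroup E] [NormedSpace ℝ E]
  [TopologicalSpace X] [ChartedSpace E X] [NormedAddCommGroup EP] [NormedSpace ℝ EP]
  [TopologicalSpace P] [ChartedSpace EP P] {B : PrincipalUBundle m E X EP P}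

/-- Over every point there is a point at which the pullback of forms along the projection is
injective. -/
theorem exists_pullback_proj_injective [IsManifold 𝓘(ℝ, E) ∞ X] {F : Type*}
    [NormedAddCommGroup F] [NormedSpace ℝ F] (B : PrincipalUBundle m E X EP P) (x : X) :
    ∃ p, B.proj p = x ∧ ∀ {k : ℕ} (α β : DForm E X F k),
      pullback (E := EP) B.proj α p = pullback B.proj β p → α x = β x := by
  obtain ⟨V, hV, hx, s, h, hs, -, hps, -⟩ := B.exists_section x
  have hsx : MDifferentiableAt 𝓘(ℝ, E) 𝓘(ℝ, EP) s x :=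
    (hs.contMDiffAt (hV.mem_nhds hx)).mdifferentiableAt (by simp)
  refine ⟨s x, hps x hx, fun α β hαβ => ?_⟩
  -- Hence `s^* π^*` is the identity near `x`, and the pullback along `π` at `s x` determines the
  -- form at `x`.
  have h1 : B.proj ∘ s =ᶠ[nhds x] id := by
    filter_upwards [hV.mem_nhds hx] with y hy using hps y hy
  have h2 : ∀ {k : ℕ} (γ : DForm E X F k),
      γ x = (pullback (E := EP) B.proj γ (s x)).compContinuousLinearMap
        (mfderiv 𝓘(ℝ, E) 𝓘(ℝ, EP) s x) := by
    intro k γ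
    have h3 := pullback_comp_at (E := E) (E' := EP) γ
      (B.contMDiff_proj.mdifferentiableAt (x := s x) (by simp)) hsx
    rw [pullback_congr_at γ h1, pullback_id] at h3
    exact h3
  rw [h2 α, h2 β, hαβ]

theorem pullback_proj_injective [IsManifold 𝓘(ℝ, E) ∞ X] {F : Type*}
    [NormedAddCommGroup F] [NormedSpace ℝ F] {k : ℕ} {α β : DForm E X F k}
    (h : pullback (E := EP) B.proj α = pullback B.proj β) : α = β := by
  funext x
  obtain ⟨p, -, hp⟩ := B.exists_pullback_proj_injective (F := F) x
  exact hp α β (congrFun h p)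

namespace Connection

theorem isChernForm_iff (A : B.Connection) (k : ℕ) (η : smoothForms E X ℝ (2 * k)) :
    A.IsChernForm k η ↔
      mapForm Complex.ofRealCLM (pullback (E := EP) B.proj η.1) = A.totalChernForm k := by
  constructor
  · intro h
    funext p
    exact ContinuousAlternatingMap.ext fun v => h p v
  · intro h p v
    rw [← h]
    rfl

theorem mapForm_ofReal_injective {M : Type*} [TopologicalSpace M] [ChartedSpace E M] {k : ℕ}
    {α β : DForm E M ℝ k} (h : mapForm Complex.ofRealCLM α = mapForm Complex.ofRealCLM β) :
    α = β := by
  funext x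
  refine ContinuousAlternatingMap.ext fun (v : Fin k → E) => ?_
  have h1 := congrArg (fun γ : E [⋀^Fin k]→L[ℝ] ℂ => γ v) (congrFun h x)
  exact Complex.ofReal_injective h1

theorem isChernForm_unique [IsManifold 𝓘(ℝ, E) ∞ X] (A : B.Connection) (k : ℕ) {η η' : smoothForms E X ℝ (2 * k)}
    (h : A.IsChernForm k η) (h' : A.IsChernForm k η') : η = η' := by
  rw [isChernForm_iff] at h h'
  exact Subtype.ext (pullback_proj_injective (mapForm_ofReal_injective (h.trans h'.symm)))

variable [IsManifold 𝓘(ℝ, EP) ∞ P] [FiniteDimensional ℝ EP]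

theorem smoothFormAt_totalChernForm (A : B.Connection) (k : ℕ) (p : P) :
    SmoothFormAt (A.totalChernForm k) p :=
  smoothFormAt_chernForm A.smoothFormAt p

/-- The form `C_k(F ∧ ⋯ ∧ F)` descends to the base. -/
theorem exists_pullback_proj_eq [IsManifold 𝓘(ℝ, E) ∞ X] [FiniteDimensional ℝ E]
    (A : B.Connection) (k : ℕ) : ∃ η : DForm E X ℂ (2 * k),
      (∀ x, SmoothFormAt η x) ∧ pullback (E := EP) B.proj η = A.totalChernForm k := by
  choose V hV hxV s h hs hh hps hact using B.exists_section
  obtain ⟨η, hη⟩ : ∃ η : DForm E X ℂ (2 * k),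
      ∀ x, η x = pullback (E := E) (s x) (A.totalChernForm k) x := ⟨_, fun _ => rfl⟩
  -- `η` was defined with a different section at each point. Any two candidates have the same
  -- pullback to `P`, so near `x₀` the single section `s x₀` computes it, which gives smoothness.
  have hloc : ∀ x₀, ∀ x ∈ V x₀, η x = pullback (E := E) (s x₀) (A.totalChernForm k) x := by
    intro x₀ x hx
    obtain ⟨p, hp, hinj⟩ := B.exists_pullback_proj_injective (F := ℂ) x
    have h1 := A.totalChernForm_eq_pullback_section k (hV x) (hs x) (hh x) (hact x)
      (p := p) (by rw [hp]; exact hxV x)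
    have h2 := A.totalChernForm_eq_pullback_section k (hV x₀) (hs x₀) (hh x₀) (hact x₀)
      (p := p) (by rw [hp]; exact hx)
    rw [hη]
    exact hinj (pullback (E := E) (s x) (A.totalChernForm k))
      (pullback (E := E) (s x₀) (A.totalChernForm k)) (h1.symm.trans h2)
  refine ⟨η, fun x => ?_, ?_⟩
  · refine SmoothFormAt.congr
      ((A.smoothFormAt_totalChernForm k (s x x)).pullback
        ((hs x).contMDiffAt ((hV x).mem_nhds (hxV x)))) ?_
    filter_upwards [(hV x).mem_nhds (hxV x)] with y hy using hloc x y hy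
  · funext p
    rw [A.totalChernForm_eq_pullback_section k (hV (B.proj p)) (hs _) (hh _) (hact _) (hxV _),
      pullback, pullback, hη]

theorem exists_isChernForm [IsManifold 𝓘(ℝ, E) ∞ X] [FiniteDimensional ℝ E]
    (A : B.Connection) (k : ℕ) : ∃ η : smoothForms E X ℝ (2 * k), A.IsChernForm k η := by
  obtain ⟨η, hη, hπ⟩ := A.exists_pullback_proj_eq k
  -- Taking real parts loses nothing, since the form on `P` is invariant under conjugation.
  have hmem : mapForm Complex.reCLM η ∈ smoothForms E X ℝ (2 * k) :=
    mem_smoothForms_iff.2 fun x => (hη x).mapForm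
  refine ⟨⟨mapForm Complex.reCLM η, hmem⟩, (A.isChernForm_iff k _).2 ?_⟩
  rw [pullback_mapForm, hπ]
  funext p
  exact ContinuousAlternatingMap.ext fun v =>
    Complex.conj_eq_iff_re.1 (A.conj_totalChernForm k p v)

/-- `π^* dη` is the exterior derivative of the closed form on `P`, and `π^*` is injective. -/
theorem extD_isChernForm [IsManifold 𝓘(ℝ, E) ∞ X] [FiniteDimensional ℝ E] (A : B.Connection) (k : ℕ) {η : smoothForms E X ℝ (2 * k)}
    (h : A.IsChernForm k η) : extD η = 0 := by
  rw [isChernForm_iff] at h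
  have hη : ∀ x, SmoothFormAt η.1 x := mem_smoothForms_iff.1 η.2
  rw [extD_eq]
  refine pullback_proj_injective (B := B) (mapForm_ofReal_injective ?_)
  funext p
  have hpr := B.contMDiff_proj.contMDiffAt (x := p)
  have h1 := extDForm_mapForm (L := Complex.ofRealCLM) ((hη (B.proj p)).pullback hpr)
  rw [h] at h1
  have h2 : extDForm (A.totalChernForm k) p = 0 := extDForm_chernForm A.smoothFormAt p
  have h3 : pullback (E := EP) B.proj (0 : DForm E X ℝ (2 * k + 1)) = 0 := rfl
  have h4 : mapForm Complex.ofRealCLM (extDForm (pullback (E := EP) B.proj η.1)) p =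
      mapForm Complex.ofRealCLM (pullback (E := EP) B.proj (extDForm η.1)) p := by
    change Complex.ofRealCLM.compContinuousAlternatingMap _ =
      Complex.ofRealCLM.compContinuousAlternatingMap _
    rw [extDForm_pullback (hη (B.proj p)) hpr]
  rw [← h4, ← h1, h2, h3]
  refine ContinuousAlternatingMap.ext fun (v : Fin (2 * k + 1) → EP) => ?_
  exact Complex.ofReal_zero.symm

/-- Conjugation is a real-linear ring homomorphism, so `Θ^*ω = conj ω` gives `Θ^*F = conj F`. The
sign is that of `conj_chernPoly`, and the conjugate left over disappears because the form is real.
-/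
theorem pullback_totalChernForm {τ : X → X} {Θ : B.RealStructure τ} {A : B.Connection}
    (hA : A.IsReal Θ) (k : ℕ) :
    pullback (E := EP) Θ.toFun (A.totalChernForm k) = (-1 : ℝ) ^ k • A.totalChernForm k := by
  let S : Mat m →L[ℝ] Mat m := LinearMap.toContinuousLinearMap
    { toFun := fun A => A.map (starRingEnd ℂ)
      map_add' := fun A B => Matrix.map_add _ (map_add _) A B
      map_smul' := fun c A => by ext i j; simp }
  have hmul : ∀ A B, S (A * B) = S A * S B := fun A B => by
    change (A * B).map (starRingEnd ℂ) = _
    rw [Matrix.map_mul]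
    rfl
  have hS : pullback (E := EP) Θ.toFun A.form.1 = mapForm S A.form.1 := by
    funext p
    refine ContinuousAlternatingMap.ext fun (v : Fin 1 → EP) => ?_
    have h1 : S (A.form.1 p v) = (A.form.1 p v : Mat m).map (starRingEnd ℂ) := rfl
    refine Eq.trans ?_ h1.symm
    rw [← hA p v, Matrix.map_map]
    ext i j
    exact (Complex.conj_conj _).symm
  have hF : ∀ p, pullback (E := EP) Θ.toFun (curvatureForm A.form.1) p =
      mapForm S (curvatureForm A.form.1) p := by
    intro p
    rw [← curvatureForm_pullback (A.smoothFormAt _) Θ.contMDiff_toFun.contMDiffAt, hS]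
    exact curvatureForm_mapForm hmul (A.smoothFormAt p)
  rw [totalChernForm_eq, pullback_wedgePowerForm]
  funext p
  refine ContinuousAlternatingMap.ext fun (v : Fin (2 * k) → EP) => ?_
  have h0 := A.conj_totalChernForm k p v
  have h1 : A.totalChernForm k p v = _ :=
    wedgePowerForm_apply (chernPoly m k) (curvatureForm A.form.1) p v
  have h2 : ∀ w : Fin k → Fin 2 → EP,
      chernPoly m k (fun i => pullback (E := EP) Θ.toFun (curvatureForm A.form.1) p (w i)) =
        (-1) ^ k * starRingEnd ℂ (chernPoly m k (fun i => curvatureForm A.form.1 p (w i))) := by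
    intro w
    rw [conj_chernPoly, ← mul_assoc, ← mul_pow, neg_one_mul, neg_neg, one_pow, one_mul, hF p]
    rfl
  refine (wedgePowerForm_apply _ _ p v).trans ?_
  refine Eq.trans ?_ (congrArg (fun z : ℂ => (-1 : ℝ) ^ k • z) (h0.symm.trans
    (congrArg (starRingEnd ℂ) h1))).symm
  simp only [Complex.real_smul, map_mul, map_sum, Complex.conj_ofReal]
  rw [mul_left_comm]
  congr 1
  rw [Finset.mul_sum]
  refine Finset.sum_congr rfl fun σ _ => ?_
  rw [Units.smul_def, Units.smul_def, map_zsmul, mul_smul_comm]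
  congr 1
  refine (h2 _).trans ?_
  push_cast
  rfl

theorem pullback_isChernForm [IsManifold 𝓘(ℝ, E) ∞ X] {τ : X → X} (hτ : ContMDiff 𝓘(ℝ, E) 𝓘(ℝ, E) ∞ τ)
    {Θ : B.RealStructure τ} {A : B.Connection} (hA : A.IsReal Θ) (k : ℕ)
    {η : smoothForms E X ℝ (2 * k)} (h : A.IsChernForm k η) :
    pullback (E := E) τ η.1 = (-1 : ℝ) ^ k • η.1 := by
  rw [isChernForm_iff] at h
  refine pullback_proj_injective (B := B) (mapForm_ofReal_injective ?_)
  have h1 : pullback (E := EP) B.proj (pullback (E := E) τ η.1) =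
      pullback (E := EP) Θ.toFun (pullback (E := EP) B.proj η.1) := by
    funext p
    rw [← pullback_comp_at η.1 (hτ.mdifferentiableAt (by simp))
      (B.contMDiff_proj.mdifferentiableAt (by simp)),
      ← pullback_comp_at η.1 (B.contMDiff_proj.mdifferentiableAt (by simp))
      (Θ.contMDiff_toFun.mdifferentiableAt (by simp))]
    congr 1
    funext q
    exact (Θ.equivariant q).symm
  rw [h1, ← pullback_mapForm, h, pullback_totalChernForm hA, ← h]
  funext p
  refine ContinuousAlternatingMap.ext fun (v : Fin (2 * k) → EP) => ?_
  exact (Complex.ofRealCLM.map_smul ((-1 : ℝ) ^ k) (pullback (E := EP) B.proj η.1 p v)).symm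

end Connection

end PrincipalUBundle

/-! ### Cohomology of the parity complexes -/

section Parity

theorem half_smul_add_smul {V : Type*} [AddCommGroup V] [Module ℝ V] {ε : ℝ} (hε : ε * ε = 1)
    (a b : V) : (1 / 2 : ℝ) • (b + ε • a) = ε • ((1 / 2 : ℝ) • (a + ε • b)) := by
  rw [smul_comm ε, smul_add ε, smul_smul, hε, one_smul, add_comm]

theorem half_smul_add_self {V : Type*} [AddCommGroup V] [Module ℝ V] (a : V) :
    (1 / 2 : ℝ) • (a + a) = a := by
  rw [← two_smul ℝ, smul_smul]
  norm_num

variable {E X : Type*} [NormedAddCommGroup E] [NormedSpace ℝ E] [FiniteDimensional ℝ E]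
  [TopologicalSpace X] [ChartedSpace E X] [IsManifold 𝓘(ℝ, E) ∞ X]

/-- A primitive can be averaged over the involution: if `α = dβ` and `τ^*α = εα`, then `(β + ε τ^*β)
/ 2` is a primitive of the required parity. -/
theorem parityIncl_injective {τ : X → X} (hτ : ContMDiff 𝓘(ℝ, E) 𝓘(ℝ, E) ∞ τ)
    (hτ2 : Function.Involutive τ) {ε : ℝ} (hε : ε * ε = 1) (k : ℕ) :
    Function.Injective (parityIncl (E := E) τ ε k) := by
  rw [← LinearMap.ker_eq_bot, LinearMap.ker_eq_bot']
  intro c hc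
  obtain ⟨α, rfl⟩ := Submodule.Quotient.mk_surjective _ c
  have h0 : (Submodule.Quotient.mk
      (Submodule.inclusion (cocycles_mono (fun _ => le_top) k) α) :
        Cohomology (deRhamComplex E X) k) = 0 := hc
  rw [Submodule.Quotient.mk_eq_zero] at h0
  have h1 : (α : smoothForms E X ℝ k) ∈ coboundaries (deRhamComplex E X) k := h0
  rw [Submodule.Quotient.mk_eq_zero]
  change (α : smoothForms E X ℝ k) ∈ coboundaries (parityComplex τ ε) k
  cases k with
  -- In degree `0` both spaces of coboundaries are zero.
  | zero => exact h1
  | succ k =>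
    obtain ⟨β, -, hβ⟩ := h1
    have hβs : ∀ x, SmoothFormAt β.1 x := mem_smoothForms_iff.1 β.2
    have hα : pullback τ α.1.1 = ε • α.1.1 := α.2.1
    let γ : smoothForms E X ℝ k := ⟨pullback τ β.1, mem_smoothForms_iff.2 fun x =>
      (hβs (τ x)).pullback hτ.contMDiffAt⟩
    have hγ : extD γ = ε • α.1.1 := by
      rw [← hα]
      funext x
      refine (extDForm_pullback (hβs (τ x)) hτ.contMDiffAt).trans ?_
      have h2 : extDForm β.1 = α.1.1 := hβ
      rw [h2]
    have hγτ : pullback τ γ.1 = β.1 := by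
      funext x
      have h2 := pullback_comp_at (E := E) (E' := E) β.1 (hτ.mdifferentiableAt (x := τ x) (by simp))
        (hτ.mdifferentiableAt (x := x) (by simp))
      rw [hτ2.comp_self, pullback_id] at h2
      exact h2.symm
    refine ⟨(1 / 2 : ℝ) • (β + ε • γ), ?_, ?_⟩
    · change pullback τ ((1 / 2 : ℝ) • (β.1 + ε • γ.1)) = ε • ((1 / 2 : ℝ) • (β.1 + ε • γ.1))
      rw [pullback_smul, pullback_add, pullback_smul, hγτ]
      exact half_smul_add_smul hε β.1 γ.1
    · rw [map_smul, map_add, map_smul, hγ, hβ, smul_smul, hε, one_smul]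
      exact half_smul_add_self α.1.1

theorem existsUnique_parityIncl_eq {τ : X → X} (hτ : ContMDiff 𝓘(ℝ, E) 𝓘(ℝ, E) ∞ τ)
    (hτ2 : Function.Involutive τ) {ε : ℝ} (hε : ε * ε = 1) {k : ℕ} (η : smoothForms E X ℝ k)
    (hη : extD η = 0) (h : pullback τ η.1 = ε • η.1) :
    ∃! c : Cohomology (parityComplex (E := E) τ ε) k, parityIncl τ ε k c = deRhamClass η hη := by
  refine ⟨Submodule.Quotient.mk ⟨η, h, hη⟩, rfl, fun c hc => ?_⟩
  exact parityIncl_injective hτ hτ2 hε k (hc.trans rfl)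

end Parity

end

end RealChernWeil

/-! ### The main theorem -/

theorem lemma3p3 {m : ℕ} {E X EP P : Type*}
    [NormedAddCommGroup E] [NormedSpace ℝ E] [FiniteDimensional ℝ E]
    [TopologicalSpace X] [ChartedSpace E X] [IsManifold 𝓘(ℝ, E) ∞ X]
    [NormedAddCommGroup EP] [NormedSpace ℝ EP] [FiniteDimensional ℝ EP]
    [TopologicalSpace P] [ChartedSpace EP P] [IsManifold 𝓘(ℝ, EP) ∞ P]
    (τ : X → X) (hτ : ContMDiff 𝓘(ℝ, E) 𝓘(ℝ, E) ∞ τ) (hτ2 : Function.Involutive τ)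
    (B : PrincipalUBundle m E X EP P) (Θ : B.RealStructure τ)
    (A : B.Connection) (hA : A.IsReal Θ) (k : ℕ) :
    (∃! η : smoothForms E X ℝ (2 * k), A.IsChernForm k η) ∧
    ∀ η : smoothForms E X ℝ (2 * k), A.IsChernForm k η →
      pullback τ η.1 = (-1 : ℝ) ^ k • η.1 ∧
      ∃ hη : extD η = 0,
        (Even k → ∃! c : Cohomology (parityComplex (E := E) τ 1) (2 * k),
          parityIncl τ 1 (2 * k) c = deRhamClass η hη) ∧
        (Odd k → ∃! c : Cohomology (parityComplex (E := E) τ (-1)) (2 * k),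
          parityIncl τ (-1) (2 * k) c = deRhamClass η hη) := by
  obtain ⟨η₀, hη₀⟩ := A.exists_isChernForm k
  refine ⟨⟨η₀, hη₀, fun η hη => A.isChernForm_unique k hη hη₀⟩, fun η hη => ?_⟩
  have hpar := PrincipalUBundle.Connection.pullback_isChernForm hτ hA k hη
  refine ⟨hpar, A.extD_isChernForm k hη, fun hk => ?_, fun hk => ?_⟩
  · rw [hk.neg_one_pow] at hpar
    exact existsUnique_parityIncl_eq hτ hτ2 (by norm_num) η _ hpar
  · rw [hk.neg_one_pow] at hpar
    exact existsUnique_parityIncl_eq hτ hτ2 (by norm_num) η _ hpar
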